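/- **Theorem 5 (Unitary equivalence of $L_\pm$ to $|\nabla|$ on the continuous spectrum).** Let $m \geq 1$ be an integer and $$Q_m(x) = \left( \mathrm{i}\cdot\frac{x-\mathrm{i}}{x+\mathrm{i}} \right)^m, \qquad x\in\mathbb{R}.$$ On the complex Hilbert space $L^2(\mathbb{R})$ consider the operators, both with domain $H^1(\mathbb{R})$, $$L_+ = |\nabla| - \frac{2m}{1+x^2}, \qquad L_- = L_+ + R, \qquad (Rf)(x) = \frac{1}{2\pi}\int_{\mathbb{R}} \frac{|Q_m(x)-Q_m(y)|^2}{|x-y|^2}\, f(y)\,dy ,$$ where $|\nabla|$ is the Fourier multiplier with symbol $|\xi|$ (for the Fourier transform with kernel $e^{-\mathrm{i}x\xi}$). Let $\Pi_+$ be the orthogonal projection of $L^2(\mathbb{R})$ onto the functions whose Fourier transform vanishes on $\xi<0$, and let $\Pi_- = 1-\Pi_+$. Let $P$ be the orthogonal projection of $L^2(\mathbb{R})$ onto the closed linear span of the $L^2$-eigenfunctions of $L_+$, let $P^\perp = 1-P$, and put $$U f = Q_m\, \Pi_+ f + \overline{Q}_m\, \Pi_- f .$$ Then: 1. $U$ is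 a unitary map from $L^2(\mathbb{R})$ onto $P^\perp L^2(\mathbb{R})$, with adjoint $U^* g = \overline{Q}_m\, \Pi_+ g + Q_m\, \Pi_- g$ for $g\in P^\perp L^2(\mathbb{R})$. 2. As operators on $L^2(\mathbb{R})$, including equality of their domains, $$U^* P^\perp L_+ P^\perp U = U^* P^\perp L_- P^\perp U = |\nabla| .$$ 3. The closed linear spans of the $L^2$-eigenfunctions (bound states) of $L_+$ and of $L_-$ coincide, and $L_+$ and $L_-$ have purely absolutely continuous spectrum equal to $[0,\infty)$ on the orthogonal complement of their bound states. That is, each of them has a spectral resolution, its absolutely continuous subspace is exactly this orthogonal complement $P^\perp L^2(\mathbb{R})$, and its part in this subspace has spectrum $[0,\infty)$. -/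

import Mathlib

open MeasureTheory
open scoped ENNReal InnerProductSpace FourierTransform

noncomputable section

namespace HalfHarmonic

/-! ### Unbounded operators on a complex Hilbert space -/

section Abstract

variable {H : Type*} [NormedAddCommGroup H] [InnerProductSpace ℂ H]

/-- The composition `B A C` of a partially defined operator `A` with everywhere defined operators,
on its natural domain `{f | C f ∈ dom A}`. -/
def sandwich {H₁ H₂ : Type*} [NormedAddCommGroup H₁] [InnerProductSpace ℂ H₁]
    [NormedAddCommGroup H₂] [InnerProductSpace ℂ H₂]
    (B : H →L[ℂ] H₂) (A : H →ₗ.[ℂ] H) (C : H₁ →L[ℂ] H) : H₁ →ₗ.[ℂ] H₂ where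
  domain := A.domain.comap (C : H₁ →ₗ[ℂ] H)
  toFun :=
    { toFun := fun f => B (A ⟨C f, f.2⟩)
      map_add' := fun f g => by
        rw [← map_add, ← A.map_add]
        congr 2
        exact Subtype.ext (map_add C (f : H₁) (g : H₁))
      map_smul' := fun c f => by
        rw [RingHom.id_apply, ← map_smul, ← A.map_smul]
        congr 2
        exact Subtype.ext (map_smul C c (f : H₁)) }

/-- The closed linear span of all eigenvectors of `A` (with real eigenvalues). -/
def boundStates (A : H →ₗ.[ℂ] H) : Submodule ℂ H :=
  (Submodule.span ℂ
    {f : H | ∃ (h : f ∈ A.domain) (E : ℝ), A ⟨f, h⟩ = (E : ℂ) • f}).topologicalClosure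

instance [CompleteSpace H] (A : H →ₗ.[ℂ] H) : CompleteSpace (boundStates A) := by
  unfold boundStates; infer_instance

/-- The orthogonal projection onto the bound states of `A`. -/
def boundProj [CompleteSpace H] (A : H →ₗ.[ℂ] H) : H →L[ℂ] H :=
  (boundStates A).starProjection

/-- The part of `A` in the subspace `K`: the operator on `K` with domain
`{u ∈ K ∩ dom A | A u ∈ K}` that acts as `A`. -/
def part (A : H →ₗ.[ℂ] H) (K : Submodule ℂ H) : K →ₗ.[ℂ] K where
  domain :=
    { carrier := {u | ∃ h : (u : H) ∈ A.domain, A ⟨u, h⟩ ∈ K}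
      zero_mem' := ⟨A.domain.zero_mem, by
        have : A ⟨((0 : K) : H), A.domain.zero_mem⟩ = 0 := A.map_zero
        rw [this]; exact K.zero_mem⟩
      add_mem' := by
        rintro u v ⟨hu, hu'⟩ ⟨hv, hv'⟩
        refine ⟨A.domain.add_mem hu hv, ?_⟩
        have : A ⟨((u + v : K) : H), A.domain.add_mem hu hv⟩ = A ⟨u, hu⟩ + A ⟨v, hv⟩ :=
          A.map_add ⟨u, hu⟩ ⟨v, hv⟩
        rw [this]; exact K.add_mem hu' hv'
      smul_mem' := by
        rintro c u ⟨hu, hu'⟩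
        refine ⟨A.domain.smul_mem c hu, ?_⟩
        have : A ⟨((c • u : K) : H), A.domain.smul_mem c hu⟩ = c • A ⟨u, hu⟩ :=
          A.map_smul c ⟨u, hu⟩
        rw [this]; exact K.smul_mem c hu' }
  toFun :=
    { toFun := fun u => ⟨A ⟨u, u.2.1⟩, u.2.2⟩
      map_add' := fun u v => Subtype.ext (A.map_add ⟨u, u.2.1⟩ ⟨v, v.2.1⟩)
      map_smul' := fun c u => Subtype.ext (A.map_smul c ⟨u, u.2.1⟩) }

/-- The spectrum of an unbounded operator: the set of all `z` for which `A - z` has no bounded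
everywhere defined inverse. -/
def operatorSpectrum (A : H →ₗ.[ℂ] H) : Set ℂ :=
  {z | ¬ ∃ T : H →L[ℂ] H,
    (∀ f : H, ∃ h : T f ∈ A.domain, A ⟨T f, h⟩ - z • T f = f) ∧
    ∀ u : A.domain, T (A u - z • (u : H)) = u}

/-- A projection-valued measure on the Borel sets of `ℝ`. -/
structure ProjectionValuedMeasure (H : Type*) [NormedAddCommGroup H] [InnerProductSpace ℂ H]
    [CompleteSpace H] where
  /-- The projection attached to a set; only its values on Borel sets matter. -/
  proj : Set ℝ → H →L[ℂ] H
  isStarProjection : ∀ B, MeasurableSet B → IsStarProjection (proj B)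
  proj_empty : proj ∅ = 0
  proj_univ : proj Set.univ = 1
  proj_inter : ∀ B C, MeasurableSet B → MeasurableSet C → proj (B ∩ C) = proj B * proj C
  proj_iUnion : ∀ B : ℕ → Set ℝ, (∀ n, MeasurableSet (B n)) →
    Pairwise (Function.onFun Disjoint B) →
    ∀ f, HasSum (fun n => proj (B n) f) (proj (⋃ n, B n) f)

namespace ProjectionValuedMeasure

variable [CompleteSpace H] (E : ProjectionValuedMeasure H)

lemma inner_proj_eq (B : Set ℝ) (hB : MeasurableSet B) (f : H) :
    (⟪f, E.proj B f⟫_ℂ).re = ‖E.proj B f‖ ^ 2 := by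
  have h := E.isStarProjection B hB
  have h1 : E.proj B (E.proj B f) = E.proj B f := by
    have := h.isIdempotentElem
    exact congrArg (fun T : H →L[ℂ] H => T f) this
  have h2 : ContinuousLinearMap.adjoint (E.proj B) = E.proj B := h.isSelfAdjoint
  have h3 : ⟪E.proj B f, E.proj B f⟫_ℂ = ⟪f, E.proj B f⟫_ℂ := by
    rw [← ContinuousLinearMap.adjoint_inner_right, h2, h1]
  rw [← h3, inner_self_eq_norm_sq_to_K]
  norm_cast

/-- The scalar spectral measure `B ↦ ⟪f, E(B) f⟫ = ‖E(B) f‖ ^ 2` of the vector `f`. -/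
def scalarMeasure (f : H) : Measure ℝ :=
  Measure.ofMeasurable (fun B _ => ENNReal.ofReal (‖E.proj B f‖ ^ 2))
    (by simp [E.proj_empty])
    (by
      intro B hB hd
      have h1 := E.proj_iUnion B hB hd f
      have h2 : HasSum (fun n => ‖E.proj (B n) f‖ ^ 2) (‖E.proj (⋃ n, B n) f‖ ^ 2) := by
        have h3 := Complex.hasSum_re (h1.mapL (innerSL ℂ f))
        simp only [innerSL_apply_apply] at h3
        rw [E.inner_proj_eq _ (MeasurableSet.iUnion hB)] at h3
        simpa only [E.inner_proj_eq _ (hB _)] using h3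
      rw [← h2.tsum_eq, ENNReal.ofReal_tsum_of_nonneg (fun n => by positivity) h2.summable])

lemma scalarMeasure_apply (f : H) {B : Set ℝ} (hB : MeasurableSet B) :
    E.scalarMeasure f B = ENNReal.ofReal (‖E.proj B f‖ ^ 2) :=
  Measure.ofMeasurable_apply B hB

lemma scalarMeasure_ac_iff (f : H) :
    E.scalarMeasure f ≪ volume ↔
      ∀ B, MeasurableSet B → volume B = 0 → E.proj B f = 0 := by
  constructor
  · intro h B hB h0
    have := h h0
    rw [E.scalarMeasure_apply f hB] at this
    simpa using this
  · intro h
    refine Measure.AbsolutelyContinuous.mk fun B hB h0 => ?_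
    rw [E.scalarMeasure_apply f hB, h B hB h0]
    simp

/-- `A = ∫ t dE(t)`: the domain of `A` is `{f | ∫ t ^ 2 d⟪f, E(t) f⟫ < ∞}`, and there
`⟪f, A f⟫ = ∫ t d⟪f, E(t) f⟫`. -/
def Represents (A : H →ₗ.[ℂ] H) : Prop :=
  (∀ f : H, f ∈ A.domain ↔ ∫⁻ t, ENNReal.ofReal (t ^ 2) ∂(E.scalarMeasure f) < ∞) ∧
  ∀ f : A.domain, ⟪(f : H), A f⟫_ℂ = ((∫ t, t ∂(E.scalarMeasure f) : ℝ) : ℂ)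

/-- The absolutely continuous subspace: all vectors whose scalar spectral measure is absolutely
continuous with respect to Lebesgue measure. -/
def acSubspace : Submodule ℂ H where
  carrier := {f | E.scalarMeasure f ≪ volume}
  zero_mem' := by
    change E.scalarMeasure 0 ≪ volume
    rw [scalarMeasure_ac_iff]; intros; simp
  add_mem' := by
    intro f g hf hg
    change E.scalarMeasure (f + g) ≪ volume
    change E.scalarMeasure f ≪ volume at hf
    change E.scalarMeasure g ≪ volume at hg
    rw [scalarMeasure_ac_iff] at *
    intro B hB h0
    rw [map_add, hf B hB h0, hg B hB h0, add_zero]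
  smul_mem' := by
    intro c f hf
    change E.scalarMeasure (c • f) ≪ volume
    change E.scalarMeasure f ≪ volume at hf
    rw [scalarMeasure_ac_iff] at *
    intro B hB h0
    rw [map_smul, hf B hB h0, smul_zero]

end ProjectionValuedMeasure

/-- `A` has a spectral resolution `E` (hence is self-adjoint, and `E` is unique), its absolutely
continuous subspace is the whole orthogonal complement of its bound states, and the spectrum of the
part of `A` in this complement is `S`. -/
def HasPurelyACSpectrumOffBoundStates [CompleteSpace H] (A : H →ₗ.[ℂ] H) (S : Set ℝ) : Prop :=
  ∃ E : ProjectionValuedMeasure H, E.Represents A ∧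
    E.acSubspace = (boundStates A)ᗮ ∧
    operatorSpectrum (part A (boundStates A)ᗮ) = Complex.ofReal '' S

end Abstract

/-! ### Multiplication operators, Fourier projections and `|∇|` on `L²(ℝ)` -/

/-- The complex Hilbert space `L²(ℝ)`. -/
abbrev L2 : Type := Lp ℂ 2 (volume : Measure ℝ)

/-- Multiplication by a function `q`, with its maximal domain `{f ∈ L² | q f ∈ L²}`. -/
def mulOp (q : ℝ → ℂ) : L2 →ₗ.[ℂ] L2 where
  domain :=
    { carrier := {f | MemLp (fun x => q x * f x) 2 volume}
      zero_mem' := by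
        have h : (fun x => q x * (0 : L2) x) =ᵐ[volume] fun _ => (0 : ℂ) := by
          filter_upwards [Lp.coeFn_zero ℂ 2 (volume : Measure ℝ)] with x hx
          rw [hx]; simp
        exact (memLp_congr_ae h).2 MemLp.zero
      add_mem' := by
        intro f g hf hg
        have h : (fun x => q x * (f + g) x) =ᵐ[volume]
            (fun x => q x * f x) + fun x => q x * g x := by
          filter_upwards [Lp.coeFn_add f g] with x hx
          rw [hx]; simp [mul_add]
        exact (memLp_congr_ae h).2 (hf.add hg)
      smul_mem' := by
        intro c f hf
        have h : (fun x => q x * (c • f) x) =ᵐ[volume] c • fun x => q x * f x := by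
          filter_upwards [Lp.coeFn_smul c f] with x hx
          rw [hx]; simp [mul_left_comm]
        exact (memLp_congr_ae h).2 (hf.const_smul c) }
  toFun :=
    { toFun := fun f => MemLp.toLp (fun x => q x * (f : L2) x) f.2
      map_add' := by
        intro f g
        rw [← MemLp.toLp_add]
        refine MemLp.toLp_congr _ _ ?_
        filter_upwards [Lp.coeFn_add (f : L2) g] with x hx
        simp only [Submodule.coe_add, hx, Pi.add_apply, mul_add]
      map_smul' := by
        intro c f
        rw [RingHom.id_apply, ← MemLp.toLp_const_smul]
        refine MemLp.toLp_congr _ _ ?_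
        filter_upwards [Lp.coeFn_smul c (f : L2)] with x hx
        simp only [Submodule.coe_smul, hx, Pi.smul_apply, smul_eq_mul, mul_left_comm] }

/-- Multiplication by a bounded measurable function, as a bounded operator. -/
def mulBdd (q : ℝ → ℂ) (hq : Measurable q) (C : ℝ) (hC : ∀ x, ‖q x‖ ≤ C) : L2 →L[ℂ] L2 :=
  have hmem : ∀ f : L2, MemLp (fun x => q x * f x) 2 volume := fun f =>
    (Lp.memLp f).of_le_mul (hq.aestronglyMeasurable.mul (Lp.aestronglyMeasurable f))
      (Filter.Eventually.of_forall fun x => by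
        rw [norm_mul]; exact mul_le_mul_of_nonneg_right (hC x) (norm_nonneg _))
  LinearMap.mkContinuous
    { toFun := fun f => mulOp q ⟨f, hmem f⟩
      map_add' := fun f g => (mulOp q).map_add ⟨f, hmem f⟩ ⟨g, hmem g⟩
      map_smul' := fun c f => (mulOp q).map_smul c ⟨f, hmem f⟩ } C
    (fun f => by
      refine Lp.norm_le_mul_norm_of_ae_le_mul ?_
      have h : (mulOp q ⟨f, hmem f⟩ : L2) =ᵐ[volume] fun x => q x * f x :=
        MemLp.coeFn_toLp (hmem f)
      filter_upwards [h] with x hx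
      change ‖(mulOp q ⟨f, hmem f⟩ : L2) x‖ ≤ _
      rw [hx, norm_mul]
      exact mul_le_mul_of_nonneg_right (hC x) (norm_nonneg _))

/-- The Fourier transform on `L²(ℝ)`, normalized by `exp (-2 π i x ξ)`. -/
def fourierL2 : L2 ≃ₗᵢ[ℂ] L2 := Lp.fourierTransformₗᵢ ℝ ℂ

/-- The operator `|∇|`: the Fourier multiplier with symbol `2 π |ξ|`, with domain
`H¹(ℝ) = {f ∈ L² | |ξ| 𝓕 f ∈ L²}`. -/
def absNabla : L2 →ₗ.[ℂ] L2 :=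
  sandwich (fourierL2.symm.toContinuousLinearEquiv : L2 →L[ℂ] L2)
    (mulOp fun ξ => ((2 * Real.pi * |ξ| : ℝ) : ℂ))
    (fourierL2.toContinuousLinearEquiv : L2 →L[ℂ] L2)

/-- The projection `Π₊` onto nonnegative Fourier frequencies. -/
def projPos : L2 →L[ℂ] L2 :=
  (fourierL2.symm.toContinuousLinearEquiv : L2 →L[ℂ] L2) ∘L
    mulBdd (Set.indicator (Set.Ici 0) 1) (measurable_one.indicator measurableSet_Ici) 1
      (fun x => (norm_indicator_le_norm_self _ x).trans (by simp)) ∘L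
    (fourierL2.toContinuousLinearEquiv : L2 →L[ℂ] L2)

/-- The projection `Π₋ = 1 - Π₊` onto negative Fourier frequencies. -/
def projNeg : L2 →L[ℂ] L2 := 1 - projPos

/-! ### The half-harmonic map `Q_m` and the gauge transform -/

/-- `Q_m(x) = (i (x - i) / (x + i)) ^ m`. -/
def Q (m : ℕ) (x : ℝ) : ℂ :=
  (Complex.I * (((x : ℂ) - Complex.I) / ((x : ℂ) + Complex.I))) ^ m

lemma add_I_ne_zero (x : ℝ) : (x : ℂ) + Complex.I ≠ 0 := by
  intro h
  have := congrArg Complex.im h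
  simp at this

lemma norm_add_I_sq (x : ℝ) : ‖(x : ℂ) + Complex.I‖ ^ 2 = 1 + x ^ 2 := by
  rw [← Complex.normSq_eq_norm_sq, Complex.normSq_apply]
  simp; ring

lemma norm_sub_I (x : ℝ) : ‖(x : ℂ) - Complex.I‖ = ‖(x : ℂ) + Complex.I‖ := by
  rw [← Complex.norm_conj ((x : ℂ) + Complex.I)]
  simp [sub_eq_add_neg]

lemma norm_Q_one (x : ℝ) :
    ‖Complex.I * (((x : ℂ) - Complex.I) / ((x : ℂ) + Complex.I))‖ = 1 := by
  rw [norm_mul, norm_div, norm_sub_I, Complex.norm_I, one_mul,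
    div_self (norm_ne_zero_iff.2 (add_I_ne_zero x))]

lemma norm_Q (m : ℕ) (x : ℝ) : ‖Q m x‖ = 1 := by
  rw [Q, norm_pow, norm_Q_one, one_pow]

lemma measurable_Q (m : ℕ) : Measurable (Q m) := by
  unfold Q; fun_prop

/-- Multiplication by `Q_m`. -/
def mulQ (m : ℕ) : L2 →L[ℂ] L2 :=
  mulBdd (Q m) (measurable_Q m) 1 (fun x => (norm_Q m x).le)

/-- Multiplication by the complex conjugate of `Q_m`. -/
def mulQConj (m : ℕ) : L2 →L[ℂ] L2 :=
  mulBdd (fun x => (starRingEnd ℂ) (Q m x))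
    (Complex.continuous_conj.measurable.comp (measurable_Q m)) 1
    (fun x => by rw [Complex.norm_conj, norm_Q])

/-- The gauge transform `U f = Q_m Π₊ f + conj Q_m Π₋ f`, as an operator on `L²(ℝ)`. -/
def gaugeU (m : ℕ) : L2 →L[ℂ] L2 := mulQ m ∘L projPos + mulQConj m ∘L projNeg

/-! ### The operators `L₊` and `L₋` -/

/-- The potential `2 m / (1 + x ^ 2)`, as a bounded multiplication operator. -/
def potential (m : ℕ) : L2 →L[ℂ] L2 :=
  mulBdd (fun x => ((2 * m / (1 + x ^ 2) : ℝ) : ℂ)) (by fun_prop) (2 * m) (fun x => by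
    have h : (0 : ℝ) < 1 + x ^ 2 := by positivity
    rw [Complex.norm_real, Real.norm_of_nonneg (by positivity), div_le_iff₀ h]
    nlinarith [sq_nonneg x, (Nat.cast_nonneg m : (0 : ℝ) ≤ m),
      mul_nonneg (Nat.cast_nonneg m : (0 : ℝ) ≤ m) (sq_nonneg x)])

/-- The kernel `|Q_m(x) - Q_m(y)|² / (2 π |x - y|²)` of `R`. -/
def kernelR (m : ℕ) (x y : ℝ) : ℝ := ‖Q m x - Q m y‖ ^ 2 / (2 * Real.pi * |x - y| ^ 2)

lemma norm_pow_sub_pow_le_of_norm_one (a b : ℂ) (ha : ‖a‖ = 1) (hb : ‖b‖ = 1) (m : ℕ) :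
    ‖a ^ m - b ^ m‖ ≤ m * ‖a - b‖ := by
  induction m with
  | zero => simp
  | succ k ih =>
    have h : a ^ (k + 1) - b ^ (k + 1) = a * (a ^ k - b ^ k) + (a - b) * b ^ k := by ring
    rw [h]
    refine (norm_add_le _ _).trans ?_
    rw [norm_mul, norm_mul, norm_pow, ha, hb, one_pow]
    push_cast
    linarith

lemma norm_Q_sub_sq_le (m : ℕ) (x y : ℝ) :
    ‖Q m x - Q m y‖ ^ 2 ≤ 4 * m ^ 2 * |x - y| ^ 2 / ((1 + x ^ 2) * (1 + y ^ 2)) := by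
  have h0 := norm_pow_sub_pow_le_of_norm_one _ _ (norm_Q_one x) (norm_Q_one y) m
  have h1 : Complex.I * (((x : ℂ) - Complex.I) / ((x : ℂ) + Complex.I)) -
      Complex.I * (((y : ℂ) - Complex.I) / ((y : ℂ) + Complex.I)) =
      (-2 * ((x - y : ℝ) : ℂ)) / (((x : ℂ) + Complex.I) * ((y : ℂ) + Complex.I)) := by
    have hx := add_I_ne_zero x
    have hy := add_I_ne_zero y
    field_simp
    push_cast
    ring_nf
    simp only [Complex.I_sq]
    ring
  have h2 : ‖Complex.I * (((x : ℂ) - Complex.I) / ((x : ℂ) + Complex.I)) -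
      Complex.I * (((y : ℂ) - Complex.I) / ((y : ℂ) + Complex.I))‖ ^ 2 =
      4 * |x - y| ^ 2 / ((1 + x ^ 2) * (1 + y ^ 2)) := by
    rw [h1, norm_div, norm_mul, norm_mul, Complex.norm_real, div_pow, mul_pow, mul_pow,
      norm_add_I_sq, norm_add_I_sq, Real.norm_eq_abs]
    norm_num
  calc ‖Q m x - Q m y‖ ^ 2 ≤ _ := pow_le_pow_left₀ (norm_nonneg _) h0 2
    _ = _ := by rw [mul_pow, h2]; ring

lemma kernelR_nonneg (m : ℕ) (x y : ℝ) : 0 ≤ kernelR m x y := by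
  unfold kernelR
  have := Real.pi_pos
  positivity

lemma kernelR_le (m : ℕ) (x y : ℝ) :
    kernelR m x y ≤ 4 * m ^ 2 * ((1 + x ^ 2)⁻¹ * (1 + y ^ 2)⁻¹) := by
  unfold kernelR
  have hpi := Real.pi_gt_three
  have hx : (0 : ℝ) < 1 + x ^ 2 := by positivity
  have hy : (0 : ℝ) < 1 + y ^ 2 := by positivity
  have hR : (0 : ℝ) ≤ 4 * m ^ 2 * ((1 + x ^ 2)⁻¹ * (1 + y ^ 2)⁻¹) := by positivity
  rcases eq_or_ne x y with h | h
  · subst h; simpa using hR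
  · have hd : 0 < |x - y| ^ 2 := by
      have := abs_pos.2 (sub_ne_zero.2 h); positivity
    rw [div_le_iff₀ (by positivity)]
    refine (norm_Q_sub_sq_le m x y).trans ?_
    have h1 : 4 * (m : ℝ) ^ 2 * |x - y| ^ 2 / ((1 + x ^ 2) * (1 + y ^ 2)) =
        (4 * m ^ 2 * ((1 + x ^ 2)⁻¹ * (1 + y ^ 2)⁻¹)) * |x - y| ^ 2 := by
      field_simp
    rw [h1]
    refine mul_le_mul_of_nonneg_left ?_ hR
    nlinarith

lemma measurable_kernelR (m : ℕ) : Measurable (fun p : ℝ × ℝ => kernelR m p.1 p.2) := by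
  unfold kernelR
  have h1 : Measurable (fun p : ℝ × ℝ => Q m p.1) := (measurable_Q m).comp measurable_fst
  have h2 : Measurable (fun p : ℝ × ℝ => Q m p.2) := (measurable_Q m).comp measurable_snd
  exact ((h1.sub h2).norm.pow_const 2).div (by fun_prop)

lemma memLp_weight : MemLp (fun x : ℝ => (1 + x ^ 2)⁻¹) 2 volume := by
  have hm : Measurable (fun x : ℝ => (1 + x ^ 2)⁻¹) := by fun_prop
  rw [memLp_two_iff_integrable_sq hm.aestronglyMeasurable]
  refine integrable_inv_one_add_sq.mono (hm.pow_const 2).aestronglyMeasurable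
    (Filter.Eventually.of_forall fun x => ?_)
  have h1 : (1 + x ^ 2)⁻¹ ≤ 1 := inv_le_one_of_one_le₀ (by nlinarith [sq_nonneg x])
  have h0 : (0 : ℝ) ≤ (1 + x ^ 2)⁻¹ := by positivity
  rw [Real.norm_of_nonneg (by positivity), Real.norm_of_nonneg h0]
  nlinarith

lemma integrable_weight_mul (f : L2) : Integrable (fun y => (1 + y ^ 2)⁻¹ * ‖f y‖) volume :=
  memLp_weight.integrable_mul (Lp.memLp f).norm

lemma integrable_kernelR_mul (m : ℕ) (f : L2) (x : ℝ) :
    Integrable (fun y => (kernelR m x y : ℂ) * f y) volume := by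
  have hk : Measurable (fun y => kernelR m x y) :=
    Measurable.of_uncurry_left (f := fun a b => kernelR m a b) (measurable_kernelR m)
  have hk' : Measurable (fun y => (kernelR m x y : ℂ)) := Complex.measurable_ofReal.comp hk
  have hf : AEStronglyMeasurable (fun y => f y) volume := Lp.aestronglyMeasurable f
  have hI : Integrable (fun y => (4 * (m : ℝ) ^ 2 * (1 + x ^ 2)⁻¹) * ((1 + y ^ 2)⁻¹ * ‖f y‖))
      volume := (integrable_weight_mul f).const_mul _
  have hm : AEStronglyMeasurable (fun y => (kernelR m x y : ℂ) * f y) volume :=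
    hk'.aestronglyMeasurable.mul hf
  refine hI.mono' hm (Filter.Eventually.of_forall fun y => ?_)
  rw [norm_mul, Complex.norm_real, Real.norm_of_nonneg (kernelR_nonneg m x y), ← mul_assoc]
  exact mul_le_mul_of_nonneg_right ((kernelR_le m x y).trans (le_of_eq (by ring)))
    (norm_nonneg _)

/-- The integral operator `R` on functions. -/
def integralR (m : ℕ) (f : L2) (x : ℝ) : ℂ := ∫ y, (kernelR m x y : ℂ) * f y

lemma memLp_integralR (m : ℕ) (f : L2) : MemLp (integralR m f) 2 volume := by
  have hmeas : StronglyMeasurable (integralR m f) := by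
    have h : StronglyMeasurable
        (fun p : ℝ × ℝ => (kernelR m p.1 p.2 : ℂ) * f p.2) :=
      (Complex.measurable_ofReal.comp (measurable_kernelR m)).stronglyMeasurable.mul
        ((Lp.stronglyMeasurable f).comp_measurable measurable_snd)
    exact h.integral_prod_right
  refine (memLp_weight.const_mul (4 * m ^ 2 * ∫ y, (1 + y ^ 2)⁻¹ * ‖f y‖)).mono
    hmeas.aestronglyMeasurable (Filter.Eventually.of_forall fun x => ?_)
  have hI : 0 ≤ ∫ y, (1 + y ^ 2)⁻¹ * ‖f y‖ := integral_nonneg fun y => by positivity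
  have hx : (0 : ℝ) < 1 + x ^ 2 := by positivity
  rw [Real.norm_of_nonneg (by positivity)]
  refine (norm_integral_le_integral_norm _).trans ?_
  calc ∫ y, ‖(kernelR m x y : ℂ) * f y‖
      ≤ ∫ y, (4 * m ^ 2 * (1 + x ^ 2)⁻¹) * ((1 + y ^ 2)⁻¹ * ‖f y‖) := by
        refine integral_mono (integrable_kernelR_mul m f x).norm
          ((integrable_weight_mul f).const_mul _) fun y => ?_
        simp only [norm_mul, Complex.norm_real]
        rw [Real.norm_of_nonneg (kernelR_nonneg m x y), ← mul_assoc]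
        exact mul_le_mul_of_nonneg_right ((kernelR_le m x y).trans (le_of_eq (by ring)))
          (norm_nonneg _)
    _ = _ := by rw [integral_const_mul]; ring

/-- The integral operator `R` on `L²(ℝ)`. -/
def opR (m : ℕ) : L2 →ₗ[ℂ] L2 where
  toFun f := (memLp_integralR m f).toLp (integralR m f)
  map_add' f g := by
    rw [← MemLp.toLp_add]
    refine MemLp.toLp_congr _ _ (Filter.Eventually.of_forall fun x => ?_)
    rw [Pi.add_apply]
    unfold integralR
    rw [← integral_add (integrable_kernelR_mul m f x) (integrable_kernelR_mul m g x)]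
    refine integral_congr_ae ?_
    filter_upwards [Lp.coeFn_add f g] with y hy
    rw [hy, Pi.add_apply, mul_add]
  map_smul' c f := by
    rw [RingHom.id_apply, ← MemLp.toLp_const_smul]
    refine MemLp.toLp_congr _ _ (Filter.Eventually.of_forall fun x => ?_)
    rw [Pi.smul_apply]
    unfold integralR
    rw [← integral_smul]
    refine integral_congr_ae ?_
    filter_upwards [Lp.coeFn_smul c f] with y hy
    rw [hy, Pi.smul_apply, smul_eq_mul, smul_eq_mul, mul_left_comm]

/-- `L₊ = |∇| - 2 m / (1 + x ^ 2)` with domain `H¹(ℝ)`. -/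
def Lplus (m : ℕ) : L2 →ₗ.[ℂ] L2 where
  domain := absNabla.domain
  toFun := absNabla.toFun - (potential m : L2 →ₗ[ℂ] L2) ∘ₗ absNabla.domain.subtype

/-- `L₋ = L₊ + R` with domain `H¹(ℝ)`. -/
def Lminus (m : ℕ) : L2 →ₗ.[ℂ] L2 where
  domain := (Lplus m).domain
  toFun := (Lplus m).toFun + opR m ∘ₗ (Lplus m).domain.subtype

/-- `P^⊥ = 1 - P`, where `P` is the orthogonal projection onto the span of the
`L²`-eigenfunctions of `L₊`. -/
def Pperp (m : ℕ) : L2 →L[ℂ] L2 := 1 - boundProj (Lplus m)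

end HalfHarmonic

end

open HalfHarmonic ContinuousLinearMap

noncomputable section

namespace HalfHarmonic

/-! The function `Q m` is, up to a unimodular constant, the boundary value of the Blaschke product
with an `m`-fold zero at `i`. Multiplication by it therefore preserves the Hardy space `hardy` of
nonnegative frequencies, and multiplication by its conjugate preserves `hardyᗮ` (`mulQ_mem_hardy`,
`mulQConj_mem`). So `U` acts separately on the two orthogonal summands, by a unimodular factor on
each, and is an isometry.

On `hardy` the operator `|∇|` is `-i d/dx`, on `hardyᗮ` it is `i d/dx`. Since `Q_m' = i V Q_m` with
`V = 2m / (1 + x²)`, the product rule gives `|∇| U f = U |∇| f + V U f` (`IsAbsNabla.gaugeU`): the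
potential of `L₊` is exactly the commutator term, and `L₊ U = U |∇|`. The same argument for the
explicit left inverse of `U` makes the domains match (`gaugeU_mem_domain_iff`).

The orthogonal complement of the range of `U`, multiplied by `Q_m`, is the model space `hardy ⊖
Q_{2m} hardy`, which is spanned by the functions `Q_k / (x + i)` with `k < 2m`
(`mem_modelSpace_iff`, `mem_gaugeCompl_iff`). It is thus finite dimensional and contained in `H¹`. A
geometric sum shows that `R` is a finite sum of rank-one operators built from vectors of this
complement, so `R U = 0` (`opR_gaugeU`) and `L₋ U = U |∇|` as well.

The rest is abstract (`Intertwines`). By symmetry, `L₊` and `L₋` leave the complement invariant and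
are diagonalizable there; `|∇|` has no eigenvectors, so the complement is precisely the space of
bound states (`Intertwines.boundStates_eq`). A spectral resolution is that of `|∇|` transported by
`U`, plus finitely many point masses (`IsSplitting.extendPVM`). -/

/-! ### Multiplication operators and the pointwise algebra of `Q_m`. -/

lemma coeFn_mulOp (q : ℝ → ℂ) (f : (mulOp q).domain) :
    mulOp q f =ᵐ[volume] fun x => q x * (f : L2) x :=
  MemLp.coeFn_toLp f.2

lemma mem_mulOp_domain {q : ℝ → ℂ} {f : L2} :
    f ∈ (mulOp q).domain ↔ MemLp (fun x => q x * f x) 2 volume := Iff.rfl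

lemma mem_mulOp_domain_of_norm_le {q : ℝ → ℂ} (hq : Measurable q) {C : ℝ} (hC : ∀ x, ‖q x‖ ≤ C)
    (f : L2) : f ∈ (mulOp q).domain :=
  (Lp.memLp f).of_le_mul (hq.aestronglyMeasurable.mul (Lp.aestronglyMeasurable f))
    (Filter.Eventually.of_forall fun x => by
      rw [norm_mul]; exact mul_le_mul_of_nonneg_right (hC x) (norm_nonneg _))

lemma coeFn_mulBdd (q : ℝ → ℂ) (hq : Measurable q) (C : ℝ) (hC : ∀ x, ‖q x‖ ≤ C) (f : L2) :
    mulBdd q hq C hC f =ᵐ[volume] fun x => q x * f x :=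
  coeFn_mulOp q ⟨f, mem_mulOp_domain_of_norm_le hq hC f⟩

lemma mem_mulOp_domain_of_ae_eq {q : ℝ → ℂ} {f g : L2}
    (h : (g : ℝ → ℂ) =ᵐ[volume] fun x => q x * f x) : f ∈ (mulOp q).domain :=
  mem_mulOp_domain.2 ((memLp_congr_ae h).1 (Lp.memLp g))

lemma inner_L2 (f g : L2) : ⟪f, g⟫_ℂ = ∫ x, (starRingEnd ℂ) (f x) * g x := by
  rw [L2.inner_def]
  refine integral_congr_ae (Filter.Eventually.of_forall fun x => ?_)
  simp [RCLike.inner_apply, mul_comm]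

lemma coeFn_mulQ (m : ℕ) (f : L2) : mulQ m f =ᵐ[volume] fun x => Q m x * f x :=
  coeFn_mulBdd _ _ _ _ f

lemma coeFn_mulQConj (m : ℕ) (f : L2) :
    mulQConj m f =ᵐ[volume] fun x => (starRingEnd ℂ) (Q m x) * f x :=
  coeFn_mulBdd _ _ _ _ f

lemma Q_add (m n : ℕ) (x : ℝ) : Q (m + n) x = Q m x * Q n x := pow_add _ _ _

lemma conj_Q_mul_Q (m : ℕ) (x : ℝ) : (starRingEnd ℂ) (Q m x) * Q m x = 1 := by
  rw [← Complex.normSq_eq_conj_mul_self, Complex.normSq_eq_norm_sq, norm_Q]; simp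

lemma mulQ_mulQ (m n : ℕ) (f : L2) : mulQ m (mulQ n f) = mulQ (m + n) f := by
  refine Lp.ext ?_
  filter_upwards [coeFn_mulQ m (mulQ n f), coeFn_mulQ n f, coeFn_mulQ (m + n) f] with x h1 h2 h3
  rw [h1, h2, h3, Q_add, mul_assoc]

lemma mulQConj_mulQConj (m n : ℕ) (f : L2) :
    mulQConj m (mulQConj n f) = mulQConj (m + n) f := by
  refine Lp.ext ?_
  filter_upwards [coeFn_mulQConj m (mulQConj n f), coeFn_mulQConj n f,
    coeFn_mulQConj (m + n) f] with x h1 h2 h3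
  rw [h1, h2, h3, Q_add, map_mul, mul_assoc]

lemma mulQConj_mulQ (m : ℕ) (f : L2) : mulQConj m (mulQ m f) = f := by
  refine Lp.ext ?_
  filter_upwards [coeFn_mulQConj m (mulQ m f), coeFn_mulQ m f] with x h1 h2
  rw [h1, h2, ← mul_assoc, conj_Q_mul_Q, one_mul]

lemma mulQ_mulQConj (m : ℕ) (f : L2) : mulQ m (mulQConj m f) = f := by
  refine Lp.ext ?_
  filter_upwards [coeFn_mulQ m (mulQConj m f), coeFn_mulQConj m f] with x h1 h2
  rw [h1, h2, ← mul_assoc, mul_comm (Q m x), conj_Q_mul_Q, one_mul]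

lemma mulQ_zero (f : L2) : mulQ 0 f = f := by
  refine Lp.ext ?_
  filter_upwards [coeFn_mulQ 0 f] with x h1
  rw [h1, Q, pow_zero, one_mul]

lemma inner_mulQ_left (m : ℕ) (f g : L2) : ⟪mulQ m f, g⟫_ℂ = ⟪f, mulQConj m g⟫_ℂ := by
  rw [inner_L2, inner_L2]
  refine integral_congr_ae ?_
  filter_upwards [coeFn_mulQ m f, coeFn_mulQConj m g] with x h1 h2
  rw [h1, h2, map_mul]; ring

lemma inner_mulQConj_left (m : ℕ) (f g : L2) : ⟪mulQConj m f, g⟫_ℂ = ⟪f, mulQ m g⟫_ℂ := by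
  rw [inner_L2, inner_L2]
  refine integral_congr_ae ?_
  filter_upwards [coeFn_mulQConj m f, coeFn_mulQ m g] with x h1 h2
  rw [h1, h2, map_mul, Complex.conj_conj]; ring

lemma norm_mulQ (m : ℕ) (f : L2) : ‖mulQ m f‖ = ‖f‖ := by
  have h : ⟪mulQ m f, mulQ m f⟫_ℂ = ⟪f, f⟫_ℂ := by rw [inner_mulQ_left, mulQConj_mulQ]
  rw [@norm_eq_sqrt_re_inner ℂ, h, ← @norm_eq_sqrt_re_inner ℂ]

lemma norm_mulQConj (m : ℕ) (f : L2) : ‖mulQConj m f‖ = ‖f‖ := by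
  rw [← norm_mulQ m (mulQConj m f), mulQ_mulQConj]

/-! ### The Hardy space -/

lemma fourierL2_projPos (f : L2) :
    fourierL2 (projPos f) =ᵐ[volume] (Set.Ici (0 : ℝ)).indicator (fourierL2 f) := by
  have h : fourierL2 (projPos f) = mulBdd (Set.indicator (Set.Ici (0 : ℝ)) 1)
      (measurable_one.indicator measurableSet_Ici) 1
      (fun x => (norm_indicator_le_norm_self _ x).trans (by simp)) (fourierL2 f) :=
    fourierL2.apply_symm_apply _
  rw [h]
  filter_upwards [coeFn_mulBdd (Set.indicator (Set.Ici (0 : ℝ)) 1)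
      (measurable_one.indicator measurableSet_Ici) 1
      (fun x => (norm_indicator_le_norm_self _ x).trans (by simp)) (fourierL2 f)] with x hx
  rw [hx]
  by_cases h0 : x ∈ Set.Ici (0 : ℝ) <;> simp [h0]

lemma fourierL2_projNeg (f : L2) :
    fourierL2 (projNeg f) =ᵐ[volume] (Set.Iio (0 : ℝ)).indicator (fourierL2 f) := by
  have h : fourierL2 (projNeg f) = fourierL2 f - fourierL2 (projPos f) := by
    rw [← map_sub]; rfl
  rw [h]
  filter_upwards [Lp.coeFn_sub (fourierL2 f) (fourierL2 (projPos f)),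
    fourierL2_projPos f] with x h1 h2
  rw [h1, Pi.sub_apply, h2]
  by_cases h0 : 0 ≤ x
  · simp [h0]
  · simp [h0, not_le.1 h0]

lemma projPos_add_projNeg (f : L2) : projPos f + projNeg f = f := by
  simp [projNeg]

lemma projPos_eq_self_iff {f : L2} :
    projPos f = f ↔ ∀ᵐ ξ : ℝ, ξ < 0 → fourierL2 f ξ = 0 := by
  rw [← fourierL2.injective.eq_iff, Lp.ext_iff]
  constructor
  · intro h
    filter_upwards [h, fourierL2_projPos f] with x h1 h2 hx
    rw [← h1, h2]; simp [hx]
  · intro h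
    filter_upwards [h, fourierL2_projPos f] with x h1 h2
    rw [h2]
    by_cases h0 : 0 ≤ x
    · simp [h0]
    · simp [h0, h1 (not_le.1 h0)]

lemma projPos_eq_zero_iff {f : L2} :
    projPos f = 0 ↔ ∀ᵐ ξ : ℝ, 0 ≤ ξ → fourierL2 f ξ = 0 := by
  rw [← fourierL2.injective.eq_iff, Lp.ext_iff, map_zero]
  constructor
  · intro h
    filter_upwards [h, fourierL2_projPos f, Lp.coeFn_zero ℂ 2 (volume : Measure ℝ)]
      with x h1 h2 h3 hx
    rw [h2, h3] at h1; simpa [hx] using h1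
  · intro h
    filter_upwards [h, fourierL2_projPos f, Lp.coeFn_zero ℂ 2 (volume : Measure ℝ)]
      with x h1 h2 h3
    rw [h2, h3]
    by_cases h0 : 0 ≤ x
    · simp [h1 h0]
    · simp [h0]

lemma projPos_projPos (f : L2) : projPos (projPos f) = projPos f := by
  rw [projPos_eq_self_iff]
  filter_upwards [fourierL2_projPos f] with x h1 hx
  rw [h1]; simp [hx]

lemma inner_projPos_left (f g : L2) : ⟪projPos f, g⟫_ℂ = ⟪f, projPos g⟫_ℂ := by
  rw [← fourierL2.inner_map_map, ← fourierL2.inner_map_map f, inner_L2, inner_L2]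
  refine integral_congr_ae ?_
  filter_upwards [fourierL2_projPos f, fourierL2_projPos g] with x h1 h2
  rw [h1, h2]
  by_cases h0 : x ∈ Set.Ici (0 : ℝ) <;> simp [h0]

/-- The Hardy space of functions with nonnegative Fourier frequencies. -/
def hardy : Submodule ℂ L2 where
  carrier := {f | projPos f = f}
  zero_mem' := map_zero _
  add_mem' := fun {f g} (hf : projPos f = f) (hg : projPos g = g) => by
    change projPos (f + g) = f + g
    rw [map_add, hf, hg]
  smul_mem' := fun c f (hf : projPos f = f) => by
    change projPos (c • f) = c • f
    rw [map_smul, hf]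

lemma mem_hardy {f : L2} : f ∈ hardy ↔ projPos f = f := Iff.rfl

lemma projPos_mem_hardy (f : L2) : projPos f ∈ hardy := projPos_projPos f

lemma mem_hardy_orthogonal {f : L2} : f ∈ hardyᗮ ↔ projPos f = 0 := by
  rw [Submodule.mem_orthogonal]
  constructor
  · intro h
    have := h _ (projPos_mem_hardy f)
    rwa [← projPos_projPos, inner_projPos_left, inner_self_eq_zero] at this
  · intro h g hg
    rw [← mem_hardy.1 hg, inner_projPos_left, h, inner_zero_right]

lemma projNeg_mem (f : L2) : projNeg f ∈ hardyᗮ := by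
  rw [mem_hardy_orthogonal]
  change projPos (f - projPos f) = 0
  rw [map_sub, projPos_projPos, sub_self]

lemma projNeg_of_mem {f : L2} (hf : f ∈ hardyᗮ) : projNeg f = f := by
  change f - projPos f = f
  rw [mem_hardy_orthogonal.1 hf, sub_zero]

lemma projNeg_of_mem_hardy {f : L2} (hf : f ∈ hardy) : projNeg f = 0 := by
  change f - projPos f = 0
  rw [mem_hardy.1 hf, sub_self]

lemma mem_hardy_of_inner_eq_zero {f : L2} (h : ∀ g ∈ hardyᗮ, ⟪g, f⟫_ℂ = 0) : f ∈ hardy := by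
  have h1 : projNeg f = 0 := by
    have h2 := h _ (projNeg_mem f)
    have h3 : ⟪projNeg f, projPos f⟫_ℂ = 0 :=
      Submodule.inner_left_of_mem_orthogonal (projPos_mem_hardy f) (projNeg_mem f)
    rw [← projPos_add_projNeg f, inner_add_right, projPos_add_projNeg, h3, zero_add,
      inner_self_eq_zero] at h2
    exact h2
  rw [mem_hardy]
  have := projPos_add_projNeg f
  rwa [h1, add_zero] at this

/-! ### Completeness of exponentials on the half-line -/

/-- For `c < 0` the map `ξ ↦ exp (c ξ)` sends the half-line into `[0, 1]`. Vanishing moments kill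
all polynomials in `exp (c ξ)`, and Weierstrass approximation extends this to continuous functions.
-/
lemma integral_comp_exp_smul_eq_zero {g : ℝ → ℂ} (hg : IntegrableOn g (Set.Ioi 0)) {c : ℝ}
    (hc : c < 0) (h0 : ∀ n : ℕ, ∫ ξ in Set.Ioi 0, (Real.exp (c * ξ) ^ n) • g ξ = 0)
    {h : ℝ → ℝ} (hh : ContinuousOn h (Set.Icc 0 1)) :
    ∫ ξ in Set.Ioi 0, h (Real.exp (c * ξ)) • g ξ = 0 := by
  have hmem : ∀ ξ ∈ Set.Ioi (0 : ℝ), Real.exp (c * ξ) ∈ Set.Icc (0 : ℝ) 1 := fun ξ hξ =>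
    ⟨(Real.exp_pos _).le, Real.exp_le_one_iff.2 (mul_nonpos_of_nonpos_of_nonneg hc.le
      (le_of_lt hξ))⟩
  have hint : ∀ k : ℝ → ℝ, ContinuousOn k (Set.Icc 0 1) →
      IntegrableOn (fun ξ => k (Real.exp (c * ξ)) • g ξ) (Set.Ioi 0) := by
    intro k hk
    obtain ⟨C, hC⟩ := isCompact_Icc.exists_bound_of_continuousOn hk
    have hm : ContinuousOn (fun ξ => k (Real.exp (c * ξ))) (Set.Ioi 0) :=
      hk.comp (by fun_prop) hmem
    refine Integrable.bdd_smul hg C (hm.aestronglyMeasurable measurableSet_Ioi) ?_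
    filter_upwards [self_mem_ae_restrict measurableSet_Ioi] with ξ hξ
    exact hC _ (hmem ξ hξ)
  have hpoly : ∀ p : Polynomial ℝ, ∫ ξ in Set.Ioi 0, p.eval (Real.exp (c * ξ)) • g ξ = 0 := by
    intro p
    have h1 : ∀ ξ, p.eval (Real.exp (c * ξ)) • g ξ =
        ∑ n ∈ Finset.range (p.natDegree + 1), p.coeff n • (Real.exp (c * ξ) ^ n • g ξ) := by
      intro ξ
      rw [Polynomial.eval_eq_sum_range, Finset.sum_smul]
      simp only [mul_smul]
    simp only [h1]
    rw [integral_finsetSum]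
    · refine Finset.sum_eq_zero fun n _ => ?_
      rw [integral_smul, h0, smul_zero]
    · intro n _
      exact (hint (fun t => t ^ n) (by fun_prop)).smul (p.coeff n)
  rw [← norm_eq_zero]
  refine le_antisymm (le_of_forall_pos_le_add fun ε hε => ?_) (norm_nonneg _)
  set K := ∫ ξ in Set.Ioi 0, ‖g ξ‖
  have hK : 0 ≤ K := integral_nonneg fun _ => norm_nonneg _
  -- `K + 1` instead of `K`, since `K` may vanish.
  obtain ⟨p, hp⟩ := exists_polynomial_near_of_continuousOn 0 1 h hh (ε / (K + 1)) (by positivity)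
  have hsub : ∫ ξ in Set.Ioi 0, h (Real.exp (c * ξ)) • g ξ =
      ∫ ξ in Set.Ioi 0, (h (Real.exp (c * ξ)) - p.eval (Real.exp (c * ξ))) • g ξ := by
    simp only [sub_smul]
    rw [integral_sub (hint h hh) (hint (fun t => p.eval t) (by fun_prop)), hpoly, sub_zero]
  rw [hsub, zero_add]
  calc _ ≤ ∫ ξ in Set.Ioi 0, (ε / (K + 1)) * ‖g ξ‖ := by
        refine norm_integral_le_of_norm_le (hg.norm.const_mul _) ?_
        filter_upwards [self_mem_ae_restrict measurableSet_Ioi] with ξ hξ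
        rw [norm_smul]
        gcongr
        rw [Real.norm_eq_abs, abs_sub_comm]
        exact (hp _ (hmem ξ hξ)).le
    _ = ε * (K / (K + 1)) := by rw [integral_const_mul]; ring
    _ ≤ ε * 1 := by
        gcongr
        rw [div_le_one (by positivity)]; linarith
    _ = ε := mul_one ε

/-- Every test function `χ` supported in the open half-line has the form `h (exp (c ξ))` with `h t =
χ (log t / c)`. This `h` is continuous on `[0, 1]`, also at `0`, because `χ` vanishes for large
arguments. -/
lemma ae_eq_zero_of_integral_exp_smul_eq_zero {g : ℝ → ℂ} (hg : IntegrableOn g (Set.Ioi 0))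
    {c : ℝ} (hc : c < 0)
    (h0 : ∀ n : ℕ, ∫ ξ in Set.Ioi 0, (Real.exp (c * ξ) ^ n) • g ξ = 0) :
    ∀ᵐ ξ : ℝ, 0 < ξ → g ξ = 0 := by
  refine isOpen_Ioi.ae_eq_zero_of_integral_contDiff_smul_eq_zero hg.locallyIntegrableOn ?_
  intro χ hχ hcpt hsupp
  have hcont : ContinuousOn (fun t => χ (Real.log t / c)) (Set.Icc 0 1) := by
    intro t ht
    refine ContinuousAt.continuousWithinAt ?_
    rcases eq_or_lt_of_le ht.1 with rfl | hpos
    -- The neighbourhood of `0` is two-sided: `Real.log` depends only on `|t|`, and at `t = 0` its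
    -- default value `0` is harmless because `0` lies outside the support of `χ`.
    · have hev : (fun t => χ (Real.log t / c)) =ᶠ[nhds 0] fun _ => 0 := by
        obtain ⟨M, hM⟩ := hcpt.isCompact.isBounded.subset_closedBall (0 : ℝ)
        have hz : χ 0 = 0 := image_eq_zero_of_notMem_tsupport fun h =>
          lt_irrefl (0 : ℝ) (hsupp h)
        have hlt : ∀ᶠ t in nhds (0 : ℝ), |t| < Real.exp (c * (|M| + 1)) := by
          have : Filter.Tendsto (fun t : ℝ => |t|) (nhds 0) (nhds 0) := by
            simpa using (continuous_abs.tendsto (0 : ℝ))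
          exact this.eventually_lt_const (Real.exp_pos _)
        filter_upwards [hlt] with t ht
        rcases eq_or_ne t 0 with rfl | hne
        · simpa using hz
        · refine image_eq_zero_of_notMem_tsupport fun h => ?_
          have h1 := hM h
          rw [mem_closedBall_zero_iff, Real.norm_eq_abs] at h1
          have h2 : Real.log t < c * (|M| + 1) := by
            rw [← Real.log_abs, Real.log_lt_iff_lt_exp (abs_pos.2 hne)]; exact ht
          have h3 : |M| + 1 < Real.log t / c := by
            rw [lt_div_iff_of_neg hc]; linarith
          have h4 := le_abs_self (Real.log t / c)
          have h5 := le_abs_self M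
          linarith
      exact (continuousAt_const).congr hev.symm
    · have : ContinuousAt (fun t => Real.log t / c) t :=
        (Real.continuousAt_log hpos.ne').div_const c
      exact hχ.continuous.continuousAt.comp this
  have key := integral_comp_exp_smul_eq_zero hg hc h0 hcont
  have heq : ∀ ξ, χ (Real.log (Real.exp (c * ξ)) / c) = χ ξ := fun ξ => by
    rw [Real.log_exp, mul_div_cancel_left₀ _ hc.ne]
  simp only [heq] at key
  rw [← key, setIntegral_eq_integral_of_forall_compl_eq_zero]
  intro ξ hξ
  rw [image_eq_zero_of_notMem_tsupport fun h => hξ (hsupp h), zero_smul]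

/-! ### Cauchy kernels -/

/-- The function `exp (-2 π (n + 1) ξ)` on the half-line. -/
def halfExp (n : ℕ) : ℝ → ℂ :=
  (Set.Ioi (0 : ℝ)).indicator fun ξ => Complex.exp ((-(2 * Real.pi * (n + 1) : ℝ) : ℂ) * ξ)

lemma halfExp_re_neg (n : ℕ) : (-(2 * Real.pi * (n + 1) : ℝ) : ℂ).re < 0 := by
  rw [Complex.neg_re, Complex.ofReal_re, neg_lt_zero]
  have := Real.pi_pos
  positivity

lemma measurable_halfExp (n : ℕ) : Measurable (halfExp n) :=
  Measurable.indicator (by fun_prop) measurableSet_Ioi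

lemma integrable_halfExp (n : ℕ) : Integrable (halfExp n) := by
  rw [halfExp, integrable_indicator_iff measurableSet_Ioi]
  exact integrableOn_exp_mul_complex_Ioi (halfExp_re_neg n) 0

lemma norm_halfExp_le_one (n : ℕ) (ξ : ℝ) : ‖halfExp n ξ‖ ≤ 1 := by
  rw [halfExp]
  by_cases h : ξ ∈ Set.Ioi (0 : ℝ)
  · rw [Set.indicator_of_mem h, Complex.norm_exp, Real.exp_le_one_iff]
    have h1 := halfExp_re_neg n
    rw [Complex.mul_re, Complex.ofReal_im, mul_zero, sub_zero, Complex.ofReal_re]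
    exact mul_nonpos_of_nonpos_of_nonneg h1.le (le_of_lt h)
  · simp [h]

lemma memLp_halfExp (n : ℕ) : MemLp (halfExp n) 2 := by
  rw [memLp_two_iff_integrable_sq_norm (measurable_halfExp n).aestronglyMeasurable]
  refine (integrable_halfExp n).norm.mono'
    ((measurable_halfExp n).norm.pow_const 2).aestronglyMeasurable
    (Filter.Eventually.of_forall fun ξ => ?_)
  have := norm_halfExp_le_one n ξ
  have h0 := norm_nonneg (halfExp n ξ)
  rw [Real.norm_of_nonneg (by positivity)]
  nlinarith

/-- The rates are `2π (n + 1)`, so the indices add up to `n + k + 1`. -/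
lemma halfExp_mul_halfExp (n k : ℕ) (ξ : ℝ) :
    halfExp n ξ * halfExp k ξ = halfExp (n + k + 1) ξ := by
  rw [halfExp, halfExp, halfExp]
  by_cases h : ξ ∈ Set.Ioi (0 : ℝ)
  · simp only [Set.indicator_of_mem h]
    rw [← Complex.exp_add]
    congr 1; push_cast; ring
  · simp [h]

lemma conj_halfExp (n : ℕ) (ξ : ℝ) : (starRingEnd ℂ) (halfExp n ξ) = halfExp n ξ := by
  rw [halfExp]
  by_cases h : ξ ∈ Set.Ioi (0 : ℝ)
  · rw [Set.indicator_of_mem h, ← Complex.exp_conj, map_mul, map_neg, Complex.conj_ofReal,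
      Complex.conj_ofReal]
  · simp [h]

lemma integral_halfExp (n : ℕ) : ∫ ξ, halfExp n ξ = (2 * Real.pi * (n + 1) : ℂ)⁻¹ := by
  rw [halfExp, integral_indicator measurableSet_Ioi,
    integral_exp_mul_complex_Ioi (halfExp_re_neg n) 0]
  push_cast
  simp [neg_div_neg_eq]

lemma fourierInv_halfExp (n : ℕ) (x : ℝ) :
    𝓕⁻ (halfExp n) x = Complex.I / (2 * Real.pi) * ((x : ℂ) + (n + 1) * Complex.I)⁻¹ := by
  rw [Real.fourierInv_eq']
  have h1 : ∀ v : ℝ, Complex.exp (↑(2 * Real.pi * inner ℝ v x) * Complex.I) • halfExp n v =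
      (Set.Ioi (0 : ℝ)).indicator (fun v : ℝ =>
        Complex.exp ((2 * Real.pi * Complex.I * (x + (n + 1) * Complex.I)) * v)) v := by
    intro v
    rw [halfExp]
    by_cases h : v ∈ Set.Ioi (0 : ℝ)
    · simp only [Set.indicator_of_mem h]
      rw [smul_eq_mul, ← Complex.exp_add]
      congr 1
      simp only [RCLike.inner_apply, conj_trivial]
      push_cast
      linear_combination (-(2 * Real.pi * (n + 1) * v) : ℂ) * Complex.I_sq
    · simp [h]
  simp only [h1]
  have hre : (2 * Real.pi * Complex.I * (x + (n + 1) * Complex.I)).re < 0 := by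
    have : (2 * Real.pi * Complex.I * (x + (n + 1) * Complex.I)) =
      ((-(2 * Real.pi * (n + 1)) : ℝ) : ℂ) + ((2 * Real.pi * x : ℝ) : ℂ) * Complex.I := by
      push_cast
      linear_combination (2 * Real.pi * (n + 1) : ℂ) * Complex.I_sq
    rw [this, Complex.add_re, Complex.re_ofReal_mul, Complex.I_re, Complex.ofReal_re]
    have := Real.pi_pos
    simp only [mul_zero, add_zero, neg_lt_zero]
    positivity
  rw [integral_indicator measurableSet_Ioi, integral_exp_mul_complex_Ioi hre]
  have hne : (x : ℂ) + (n + 1) * Complex.I ≠ 0 := by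
    intro h
    rw [h] at hre
    simp at hre
  have hpi : (Real.pi : ℂ) ≠ 0 := Complex.ofReal_ne_zero.2 Real.pi_ne_zero
  have hI := Complex.I_ne_zero
  simp only [Complex.ofReal_zero, mul_zero, Complex.exp_zero]
  field_simp
  rw [Complex.I_sq, neg_div]

/-- If the pointwise inverse Fourier transform of `u ∈ L¹ ∩ L²` is in `L²`, it agrees with the
inverse Fourier transform of `u` on `L²`. -/
lemma fourierL2_symm_eq_of_fourierInv {u : ℝ → ℂ} (hu1 : Integrable u) (hu2 : MemLp u 2) {v : L2}
    (hv : (v : ℝ → ℂ) =ᵐ[volume] 𝓕⁻ u) : fourierL2.symm (hu2.toLp u) = v := by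
  -- Both sides are compared as tempered distributions, into which `L²` embeds injectively; there
  -- the claim is the exchange formula `∫ (𝓕⁻ φ) u = ∫ φ (𝓕⁻ u)`.
  have hinj : Function.Injective (Lp.toTemperedDistributionCLM ℂ (volume : Measure ℝ) 2) :=
    LinearMap.ker_eq_bot.1 Lp.ker_toTemperedDistributionCLM_eq_bot
  apply hinj
  have h1 := Lp.fourierInv_toTemperedDistribution_eq (hu2.toLp u)
  rw [Lp.toTemperedDistributionCLM_apply, Lp.toTemperedDistributionCLM_apply]
  change ((𝓕⁻ (hu2.toLp u) : L2) : TemperedDistribution ℝ ℂ) = _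
  rw [← h1]
  ext φ
  rw [TemperedDistribution.fourierInv_apply, Lp.toTemperedDistribution_apply,
    Lp.toTemperedDistribution_apply]
  have h2 : ∫ x, (𝓕⁻ φ) x • (hu2.toLp u) x = ∫ x, (𝓕⁻ (φ : ℝ → ℂ)) x • u x := by
    refine integral_congr_ae ?_
    filter_upwards [hu2.coeFn_toLp] with x hx
    rw [hx, SchwartzMap.fourierInv_coe]
  have h3 : ∫ x, φ x • v x = ∫ x, φ x • 𝓕⁻ u x := by
    refine integral_congr_ae ?_
    filter_upwards [hv] with x hx
    rw [hx]
  rw [h2, h3]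
  have hflip : (-innerₗ ℝ : ℝ →ₗ[ℝ] ℝ →ₗ[ℝ] ℝ).flip = -innerₗ ℝ := by
    ext; simp
  have h4 := VectorFourier.integral_fourierIntegral_smul_eq_flip (L := -innerₗ ℝ) (μ := volume)
    (ν := volume) Real.continuous_fourierChar
    (by
      simp only [LinearMap.neg_apply, innerₗ_apply_apply]
      exact continuous_inner.neg) φ.integrable hu1
  rw [hflip] at h4
  exact h4

/-- The function `1 / (x + (n + 1) i)`. -/
def cauchyFun (n : ℕ) (x : ℝ) : ℂ := ((x : ℂ) + (n + 1) * Complex.I)⁻¹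

lemma add_mul_I_ne_zero (n : ℕ) (x : ℝ) : (x : ℂ) + (n + 1) * Complex.I ≠ 0 := by
  intro h
  have h1 := congrArg Complex.im h
  have h2 : ((n : ℂ) + 1) = ((n + 1 : ℝ) : ℂ) := by push_cast; rfl
  rw [h2, Complex.add_im, Complex.ofReal_im, Complex.im_ofReal_mul, Complex.I_im,
    Complex.zero_im] at h1
  have : (0 : ℝ) < n + 1 := by positivity
  linarith

lemma measurable_cauchyFun (n : ℕ) : Measurable (cauchyFun n) := by
  unfold cauchyFun; fun_prop

lemma norm_cauchyFun_sq_le (n : ℕ) (x : ℝ) : ‖cauchyFun n x‖ ^ 2 ≤ (1 + x ^ 2)⁻¹ := by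
  have h2 : ((n : ℂ) + 1) = ((n + 1 : ℝ) : ℂ) := by push_cast; rfl
  rw [cauchyFun, norm_inv, inv_pow, ← Complex.normSq_eq_norm_sq, Complex.normSq_apply, h2]
  refine inv_anti₀ (by positivity) ?_
  simp only [Complex.add_re, Complex.ofReal_re, Complex.re_ofReal_mul, Complex.I_re,
    Complex.add_im, Complex.ofReal_im, Complex.im_ofReal_mul, Complex.I_im]
  nlinarith [(Nat.cast_nonneg n : (0 : ℝ) ≤ n)]

lemma memLp_cauchyFun (n : ℕ) : MemLp (cauchyFun n) 2 := by
  rw [memLp_two_iff_integrable_sq_norm (measurable_cauchyFun n).aestronglyMeasurable]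
  refine integrable_inv_one_add_sq.mono'
    ((measurable_cauchyFun n).norm.pow_const 2).aestronglyMeasurable
    (Filter.Eventually.of_forall fun x => ?_)
  rw [Real.norm_of_nonneg (by positivity)]
  exact norm_cauchyFun_sq_le n x

/-- The function `1 / (x + (n + 1) i)` in `L²`. -/
def cauchy (n : ℕ) : L2 := (memLp_cauchyFun n).toLp

lemma coeFn_cauchy (n : ℕ) : cauchy n =ᵐ[volume] cauchyFun n := MemLp.coeFn_toLp _

lemma fourierL2_cauchy (n : ℕ) :
    fourierL2 (cauchy n) = (-(2 * Real.pi * Complex.I)) • (memLp_halfExp n).toLp := by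
  rw [← LinearIsometryEquiv.eq_symm_apply, map_smul,
    fourierL2_symm_eq_of_fourierInv (integrable_halfExp n) (memLp_halfExp n)
      (v := (Complex.I / (2 * Real.pi)) • cauchy n), smul_smul]
  · have : (-(2 * Real.pi * Complex.I)) * (Complex.I / (2 * Real.pi)) = 1 := by
      have hpi : (Real.pi : ℂ) ≠ 0 := Complex.ofReal_ne_zero.2 Real.pi_ne_zero
      field_simp
      rw [Complex.I_sq, neg_neg]
    rw [this, one_smul]
  · filter_upwards [Lp.coeFn_smul (Complex.I / (2 * Real.pi)) (cauchy n), coeFn_cauchy n]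
      with x h1 h2
    rw [h1, Pi.smul_apply, h2, fourierInv_halfExp, cauchyFun, smul_eq_mul]

lemma coeFn_fourierL2_cauchy (n : ℕ) :
    fourierL2 (cauchy n) =ᵐ[volume] fun ξ => (-(2 * Real.pi * Complex.I)) * halfExp n ξ := by
  rw [fourierL2_cauchy]
  filter_upwards [Lp.coeFn_smul (-(2 * Real.pi * Complex.I)) (memLp_halfExp n).toLp,
    (memLp_halfExp n).coeFn_toLp] with x h1 h2
  rw [h1, Pi.smul_apply, h2, smul_eq_mul]

lemma cauchy_mem_hardy (n : ℕ) : cauchy n ∈ hardy := by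
  rw [mem_hardy, projPos_eq_self_iff]
  filter_upwards [coeFn_fourierL2_cauchy n] with ξ h hξ
  rw [h, halfExp, Set.indicator_of_notMem (by simpa using hξ.le), mul_zero]

/-- By Plancherel this is `(2π)²` times the integral of `exp (-2π (n + k + 2) ξ)` over the
half-line. In particular `‖cauchy 0‖² = π`, the normalization used for the projections onto `cauchy
0` below. -/
lemma inner_cauchy_cauchy (n k : ℕ) :
    ⟪cauchy n, cauchy k⟫_ℂ = 2 * Real.pi / (n + k + 2) := by
  rw [← fourierL2.inner_map_map, inner_L2]
  have h : ∫ ξ, (starRingEnd ℂ) (fourierL2 (cauchy n) ξ) * fourierL2 (cauchy k) ξ =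
      ∫ ξ, (2 * Real.pi) ^ 2 * halfExp (n + k + 1) ξ := by
    refine integral_congr_ae ?_
    filter_upwards [coeFn_fourierL2_cauchy n, coeFn_fourierL2_cauchy k] with ξ h1 h2
    rw [h1, h2, ← halfExp_mul_halfExp, map_mul, conj_halfExp]
    simp only [map_neg, map_mul, Complex.conj_I, Complex.conj_ofReal, map_ofNat]
    linear_combination (-(2 * Real.pi) ^ 2 * halfExp n ξ * halfExp k ξ : ℂ) * Complex.I_sq
  rw [h, integral_const_mul, integral_halfExp]
  have hpi : (Real.pi : ℂ) ≠ 0 := Complex.ofReal_ne_zero.2 Real.pi_ne_zero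
  have hnk : (n : ℂ) + k + 2 ≠ 0 := by
    have : (n : ℂ) + k + 2 = ((n + k + 2 : ℕ) : ℂ) := by push_cast; ring
    rw [this, Nat.cast_ne_zero]; omega
  push_cast
  rw [show (n : ℂ) + k + 1 + 1 = n + k + 2 by ring]
  field_simp

/-- The functions `1 / (x + (n + 1) i)` with `n ≥ 1` are total in the Hardy space. -/
lemma projPos_eq_zero_of_inner_cauchy {f : L2} (h : ∀ n, 1 ≤ n → ⟪cauchy n, f⟫_ℂ = 0) :
    projPos f = 0 := by
  rw [projPos_eq_zero_iff]
  -- The factor `halfExp 1` makes `g` integrable as a product of two `L²` functions; pairing `f`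
  -- with `cauchy (n + 1)` then gives, up to a constant, the `n`-th moment of `g` in the variable
  -- `exp (-2π ξ)`.
  set g : ℝ → ℂ := fun ξ => halfExp 1 ξ * fourierL2 f ξ
  have hg : Integrable g := (memLp_halfExp 1).integrable_mul (Lp.memLp (fourierL2 f))
  have hc : -(2 * Real.pi) < 0 := by have := Real.pi_pos; linarith
  have h0 : ∀ n : ℕ, ∫ ξ in Set.Ioi 0, (Real.exp (-(2 * Real.pi) * ξ) ^ n) • g ξ = 0 := by
    intro n
    have h1 := h (n + 1) (by omega)
    rw [← fourierL2.inner_map_map, inner_L2] at h1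
    have h2 : ∫ ξ, (starRingEnd ℂ) (fourierL2 (cauchy (n + 1)) ξ) * fourierL2 f ξ =
        (2 * Real.pi * Complex.I) * ∫ ξ, halfExp (n + 1) ξ * fourierL2 f ξ := by
      rw [← integral_const_mul]
      refine integral_congr_ae ?_
      filter_upwards [coeFn_fourierL2_cauchy (n + 1)] with ξ h3
      rw [h3, map_mul, conj_halfExp]
      simp only [map_neg, map_mul, Complex.conj_I, Complex.conj_ofReal, map_ofNat]
      ring
    rw [h2, mul_eq_zero] at h1
    have h4 := h1.resolve_left (by simp [Real.pi_ne_zero])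
    rw [← h4, ← integral_indicator measurableSet_Ioi]
    congr 1
    ext ξ
    by_cases hξ : ξ ∈ Set.Ioi (0 : ℝ)
    · rw [Set.indicator_of_mem hξ, Complex.real_smul, ← mul_assoc, halfExp, halfExp,
        Set.indicator_of_mem hξ, Set.indicator_of_mem hξ, ← Real.exp_nat_mul,
        Complex.ofReal_exp, ← Complex.exp_add]
      congr 2; push_cast; ring
    · rw [Set.indicator_of_notMem hξ, halfExp, Set.indicator_of_notMem hξ, zero_mul]
  have h5 := ae_eq_zero_of_integral_exp_smul_eq_zero hg.integrableOn hc h0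
  have h6 : ∀ᵐ ξ : ℝ, ξ ≠ 0 := by simp [ae_iff]
  filter_upwards [h5, h6] with ξ h7 h8 h9
  have hpos : 0 < ξ := lt_of_le_of_ne h9 h8.symm
  refine (mul_eq_zero.1 (h7 hpos)).resolve_left ?_
  rw [halfExp, Set.indicator_of_mem (show ξ ∈ Set.Ioi (0 : ℝ) from hpos)]
  exact Complex.exp_ne_zero _

/-! ### Multiplication by `Q` on the Hardy space -/

/-- Partial fractions with simple poles at `-i` and `-(n + 1) i`. For `n = 0` the two poles would
merge, which is why totality of the Cauchy kernels is stated for `n ≥ 1` only. -/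
lemma mulQ_one_cauchy {n : ℕ} (hn : 1 ≤ n) :
    mulQ 1 (cauchy n) = (Complex.I * (n + 2) / n) • cauchy n - (2 * Complex.I / n) • cauchy 0 := by
  refine Lp.ext ?_
  filter_upwards [coeFn_mulQ 1 (cauchy n), coeFn_cauchy n, coeFn_cauchy 0,
    Lp.coeFn_sub ((Complex.I * (n + 2) / n) • cauchy n) ((2 * Complex.I / n) • cauchy 0),
    Lp.coeFn_smul (Complex.I * (n + 2) / n) (cauchy n),
    Lp.coeFn_smul (2 * Complex.I / n) (cauchy 0)] with x h1 h2 h3 h4 h5 h6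
  rw [h1, h4, Pi.sub_apply, h5, h6, Pi.smul_apply, Pi.smul_apply, h2, h3, cauchyFun, cauchyFun,
    smul_eq_mul, smul_eq_mul, Q, pow_one]
  have hn0 : (n : ℂ) ≠ 0 := Nat.cast_ne_zero.2 (by omega)
  have hx := add_mul_I_ne_zero n x
  rw [mul_comm] at hx
  have hx1 := add_I_ne_zero x
  simp only [Nat.cast_zero, zero_add, one_mul]
  field_simp
  ring

/-- By adjunction and totality it suffices that `Q_1` maps the kernels `cauchy n`, `n ≥ 1`, into
`hardy`, which the partial fractions show. -/
lemma mulQConj_one_mem {g : L2} (hg : g ∈ hardyᗮ) : mulQConj 1 g ∈ hardyᗮ := by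
  rw [mem_hardy_orthogonal]
  refine projPos_eq_zero_of_inner_cauchy fun n hn => ?_
  rw [← inner_mulQ_left, mulQ_one_cauchy hn]
  refine Submodule.inner_right_of_mem_orthogonal (K := hardy) ?_ hg
  exact hardy.sub_mem (hardy.smul_mem _ (cauchy_mem_hardy n))
    (hardy.smul_mem _ (cauchy_mem_hardy 0))

lemma mulQConj_mem {g : L2} (m : ℕ) (hg : g ∈ hardyᗮ) : mulQConj m g ∈ hardyᗮ := by
  induction m with
  | zero =>
    have : mulQConj 0 g = g := by
      rw [← mulQ_zero (mulQConj 0 g), mulQ_mulQConj]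
    rwa [this]
  | succ k ih =>
    rw [add_comm, ← mulQConj_mulQConj]
    exact mulQConj_one_mem ih

/-- Dual to `mulQConj_mem`, since `mulQ m` and `mulQConj m` are adjoint to each other. -/
lemma mulQ_mem_hardy {f : L2} (m : ℕ) (hf : f ∈ hardy) : mulQ m f ∈ hardy := by
  refine mem_hardy_of_inner_eq_zero fun g hg => ?_
  rw [← inner_mulQConj_left]
  exact Submodule.inner_left_of_mem_orthogonal hf (mulQConj_mem m hg)

/-- The function is `-i / (x - i)`, whose only pole is in the upper half-plane. In the proof the two
terms of the partial fraction cancel against the explicit Gram matrix of the Cauchy kernels. -/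
lemma mulQConj_one_cauchy_mem : mulQConj 1 (cauchy 0) ∈ hardyᗮ := by
  rw [mem_hardy_orthogonal]
  refine projPos_eq_zero_of_inner_cauchy fun n hn => ?_
  rw [← inner_mulQ_left, mulQ_one_cauchy hn, inner_sub_left, inner_smul_left, inner_smul_left,
    inner_cauchy_cauchy, inner_cauchy_cauchy]
  have hn0 : (n : ℂ) ≠ 0 := Nat.cast_ne_zero.2 (by omega)
  have hn2 : (n : ℂ) + 2 ≠ 0 := by exact_mod_cast (by omega : n + 2 ≠ 0)
  simp only [map_mul, map_div₀, map_add, Complex.conj_I, map_natCast, map_ofNat, Nat.cast_zero,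
    add_zero, zero_add]
  field_simp
  ring

/-- The space `hardy ⊖ Q_1 hardy` is a line. Orthogonality to `Q_1 cauchy n` reads `(n + 2) ⟪cauchy
n, f⟫ = 2 ⟪cauchy 0, f⟫`, so the pairing with `cauchy 0` determines all others, and `f` and its
component along `cauchy 0` have equal pairings with a total family. -/
lemma eq_smul_cauchy_of_inner_eq_zero {f : L2} (hf : f ∈ hardy)
    (h : ∀ g ∈ hardy, ⟪mulQ 1 g, f⟫_ℂ = 0) : ∃ c : ℂ, f = c • cauchy 0 := by
  refine ⟨⟪cauchy 0, f⟫_ℂ / Real.pi, ?_⟩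
  set c := ⟪cauchy 0, f⟫_ℂ / Real.pi with hc
  have hpi : (Real.pi : ℂ) ≠ 0 := Complex.ofReal_ne_zero.2 Real.pi_ne_zero
  have hmem : f - c • cauchy 0 ∈ hardy :=
    hardy.sub_mem hf (hardy.smul_mem _ (cauchy_mem_hardy 0))
  have hz : projPos (f - c • cauchy 0) = 0 := by
    refine projPos_eq_zero_of_inner_cauchy fun n hn => ?_
    have h1 := h _ (cauchy_mem_hardy n)
    have hn0 : (n : ℂ) ≠ 0 := Nat.cast_ne_zero.2 (by omega)
    have hn2 : (n : ℂ) + 2 ≠ 0 := by exact_mod_cast (by omega : n + 2 ≠ 0)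
    rw [mulQ_one_cauchy hn, inner_sub_left, inner_smul_left, inner_smul_left] at h1
    simp only [map_mul, map_div₀, map_add, Complex.conj_I, map_natCast, map_ofNat] at h1
    have h2 : ⟪cauchy n, f⟫_ℂ * (n + 2) = 2 * ⟪cauchy 0, f⟫_ℂ := by
      field_simp at h1
      have h3 : Complex.I * (⟪cauchy n, f⟫_ℂ * (n + 2) - 2 * ⟪cauchy 0, f⟫_ℂ) = 0 := by
        linear_combination -h1
      have := (mul_eq_zero.1 h3).resolve_left Complex.I_ne_zero
      linear_combination this
    rw [inner_sub_right, inner_smul_right, inner_cauchy_cauchy, hc]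
    simp only [Nat.cast_zero, add_zero]
    field_simp
    linear_combination h2
  rw [mem_hardy.1 hmem, sub_eq_zero] at hz
  exact hz

/-- The hypothesis `h0` says that `f` vanishes at `i`, the zero of `Q_1`, so `f` can be divided by
`Q_1` within the Hardy space. In the proof, for `g ⊥ hardy` the vector `Π₊ (Q_1 g)` is orthogonal to
`Q_1 hardy` and hence a multiple of `cauchy 0`. -/
lemma mulQConj_one_mem_hardy {f : L2} (hf : f ∈ hardy) (h0 : ⟪cauchy 0, f⟫_ℂ = 0) :
    mulQConj 1 f ∈ hardy := by
  refine mem_hardy_of_inner_eq_zero fun g hg => ?_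
  obtain ⟨c, hc⟩ := eq_smul_cauchy_of_inner_eq_zero (projPos_mem_hardy (mulQ 1 g)) fun h hh => by
    rw [← inner_projPos_left, mem_hardy.1 (mulQ_mem_hardy 1 hh), inner_mulQ_left, mulQConj_mulQ]
    exact Submodule.inner_right_of_mem_orthogonal hh hg
  rw [← inner_mulQ_left, ← mem_hardy.1 hf, ← inner_projPos_left, hc, inner_smul_left, h0, mul_zero]

/-! ### Model spaces `hardy ⊖ Q_n hardy`. -/

/-- The span of `Q_k / (x + i)` for `k < n`. -/
def modelSpace (n : ℕ) : Submodule ℂ L2 :=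
  Submodule.span ℂ (Set.range fun k : Fin n => mulQ k (cauchy 0))

instance (n : ℕ) : FiniteDimensional ℂ (modelSpace n) :=
  FiniteDimensional.span_of_finite ℂ (Set.finite_range _)

lemma mulQ_cauchy_mem_modelSpace {k n : ℕ} (h : k < n) : mulQ k (cauchy 0) ∈ modelSpace n :=
  Submodule.subset_span ⟨⟨k, h⟩, rfl⟩

lemma mulQ_one_mem_modelSpace {n : ℕ} {f : L2} (hf : f ∈ modelSpace n) :
    mulQ 1 f ∈ modelSpace (n + 1) := by
  refine Submodule.span_induction ?_ ?_ ?_ ?_ hf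
  · rintro _ ⟨k, rfl⟩
    dsimp only
    rw [mulQ_mulQ]
    exact mulQ_cauchy_mem_modelSpace (by have := k.2; omega)
  · rw [map_zero]; exact Submodule.zero_mem _
  · intro f g _ _ hf hg
    rw [map_add]; exact Submodule.add_mem _ hf hg
  · intro c f _ hf
    rw [map_smul]; exact Submodule.smul_mem _ _ hf

/-- After cancelling `Q_k` at least one factor `Q_1` is left on the side of `g`; moved to the other
side, it sends `cauchy 0` into `hardyᗮ`. -/
lemma inner_mulQ_cauchy_eq_zero {k n : ℕ} (hk : k < n) {g : L2} (hg : g ∈ hardy) :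
    ⟪mulQ n g, mulQ k (cauchy 0)⟫_ℂ = 0 := by
  obtain ⟨j, rfl⟩ : ∃ j, n = k + (1 + j) := ⟨n - k - 1, by omega⟩
  rw [← mulQ_mulQ, inner_mulQ_left, mulQConj_mulQ, ← mulQ_mulQ, inner_mulQ_left]
  exact Submodule.inner_right_of_mem_orthogonal (mulQ_mem_hardy j hg) mulQConj_one_cauchy_mem

/-- For the converse, induct on `n`: subtract the component of `f` along `cauchy 0`, divide by
`Q_1`, and observe that the quotient is orthogonal to `Q_n hardy`. Multiplying back by `Q_1` shifts
the spanning functions by one. -/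
lemma mem_modelSpace_iff {n : ℕ} {f : L2} :
    f ∈ modelSpace n ↔ f ∈ hardy ∧ ∀ g ∈ hardy, ⟪mulQ n g, f⟫_ℂ = 0 := by
  constructor
  · intro hf
    refine Submodule.span_induction ?_ ?_ ?_ ?_ hf
    · rintro _ ⟨k, rfl⟩
      exact ⟨mulQ_mem_hardy _ (cauchy_mem_hardy 0), fun g hg => inner_mulQ_cauchy_eq_zero k.2 hg⟩
    · exact ⟨hardy.zero_mem, fun g _ => inner_zero_right _⟩
    · rintro f g _ _ ⟨h1, h2⟩ ⟨h3, h4⟩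
      exact ⟨hardy.add_mem h1 h3, fun u hu => by rw [inner_add_right, h2 u hu, h4 u hu, add_zero]⟩
    · rintro c f _ ⟨h1, h2⟩
      exact ⟨hardy.smul_mem c h1, fun u hu => by rw [inner_smul_right, h2 u hu, mul_zero]⟩
  · rintro ⟨hf, h⟩
    induction n generalizing f with
    | zero =>
      have := h f hf
      rw [mulQ_zero, inner_self_eq_zero] at this
      rw [this]; exact Submodule.zero_mem _
    | succ n ih =>
      set c := ⟪cauchy 0, f⟫_ℂ / Real.pi with hc
      have hpi : (Real.pi : ℂ) ≠ 0 := Complex.ofReal_ne_zero.2 Real.pi_ne_zero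
      have hmem : f - c • cauchy 0 ∈ hardy :=
        hardy.sub_mem hf (hardy.smul_mem _ (cauchy_mem_hardy 0))
      have h0 : ⟪cauchy 0, f - c • cauchy 0⟫_ℂ = 0 := by
        rw [inner_sub_right, inner_smul_right, inner_cauchy_cauchy, hc]
        simp only [Nat.cast_zero, zero_add]
        field_simp
        ring
      have h1 := mulQConj_one_mem_hardy hmem h0
      have h2 := ih h1 fun g hg => by
        rw [← inner_mulQ_left, mulQ_mulQ, add_comm, inner_sub_right, h g hg, inner_smul_right,
          ← mulQ_zero (cauchy 0), inner_mulQ_cauchy_eq_zero (by omega) hg, mul_zero, sub_zero]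
      have h3 := mulQ_one_mem_modelSpace h2
      rw [mulQ_mulQConj] at h3
      have h4 : c • cauchy 0 ∈ modelSpace (n + 1) := by
        refine Submodule.smul_mem _ _ ?_
        have := mulQ_cauchy_mem_modelSpace (k := 0) (n := n + 1) (by omega)
        rwa [mulQ_zero] at this
      have := Submodule.add_mem _ h3 h4
      rwa [sub_add_cancel] at this

/-! ### The gauge transform -/

lemma gaugeU_apply (m : ℕ) (f : L2) :
    gaugeU m f = mulQ m (projPos f) + mulQConj m (projNeg f) := rfl

lemma projPos_gaugeU (m : ℕ) (f : L2) : projPos (gaugeU m f) = mulQ m (projPos f) := by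
  rw [gaugeU_apply, map_add, mem_hardy.1 (mulQ_mem_hardy m (projPos_mem_hardy f)),
    mem_hardy_orthogonal.1 (mulQConj_mem m (projNeg_mem f)), add_zero]

lemma projNeg_gaugeU (m : ℕ) (f : L2) : projNeg (gaugeU m f) = mulQConj m (projNeg f) := by
  rw [gaugeU_apply, map_add, projNeg_of_mem_hardy (mulQ_mem_hardy m (projPos_mem_hardy f)),
    projNeg_of_mem (mulQConj_mem m (projNeg_mem f)), zero_add]

lemma gaugeU_of_mem_hardy (m : ℕ) {f : L2} (hf : f ∈ hardy) : gaugeU m f = mulQ m f := by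
  rw [gaugeU_apply, projNeg_of_mem_hardy hf, mem_hardy.1 hf, map_zero, add_zero]

lemma gaugeU_of_mem_orthogonal (m : ℕ) {f : L2} (hf : f ∈ hardyᗮ) :
    gaugeU m f = mulQConj m f := by
  rw [gaugeU_apply, projNeg_of_mem hf, mem_hardy_orthogonal.1 hf, map_zero, zero_add]

/-- The explicit left inverse `g ↦ conj Q_m Π₊ g + Q_m Π₋ g` of the gauge transform. -/
lemma gaugeU_leftInverse (m : ℕ) (f : L2) :
    mulQConj m (projPos (gaugeU m f)) + mulQ m (projNeg (gaugeU m f)) = f := by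
  rw [projPos_gaugeU, projNeg_gaugeU, mulQConj_mulQ, mulQ_mulQConj, projPos_add_projNeg]

lemma norm_sq_eq_projPos_add_projNeg (f : L2) :
    ‖f‖ * ‖f‖ = ‖projPos f‖ * ‖projPos f‖ + ‖projNeg f‖ * ‖projNeg f‖ := by
  rw [← norm_add_sq_eq_norm_sq_add_norm_sq_of_inner_eq_zero (𝕜 := ℂ), projPos_add_projNeg]
  exact Submodule.inner_right_of_mem_orthogonal (projPos_mem_hardy f) (projNeg_mem f)

/-- The two pieces stay in `hardy` and `hardyᗮ`, so they remain orthogonal, and each keeps its norm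
because `|Q_m| = 1`. -/
lemma norm_gaugeU (m : ℕ) (f : L2) : ‖gaugeU m f‖ = ‖f‖ := by
  have h1 := norm_sq_eq_projPos_add_projNeg (gaugeU m f)
  rw [projPos_gaugeU, projNeg_gaugeU, norm_mulQ, norm_mulQConj,
    ← norm_sq_eq_projPos_add_projNeg] at h1
  exact (mul_self_inj (norm_nonneg _) (norm_nonneg _)).1 h1

/-- The gauge transform as a linear isometry. -/
def gaugeIsometry (m : ℕ) : L2 →ₗᵢ[ℂ] L2 := ⟨(gaugeU m : L2 →ₗ[ℂ] L2), norm_gaugeU m⟩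

lemma gaugeIsometry_apply (m : ℕ) (f : L2) : gaugeIsometry m f = gaugeU m f := rfl

lemma adjoint_gaugeU_gaugeU (m : ℕ) (f : L2) :
    ContinuousLinearMap.adjoint (gaugeU m) (gaugeU m f) = f := by
  refine ext_inner_left ℂ fun g => ?_
  rw [ContinuousLinearMap.adjoint_inner_right]
  exact (gaugeIsometry m).inner_map_map g f

/-- The orthogonal complement of the range of the gauge transform. -/
def gaugeCompl (m : ℕ) : Submodule ℂ L2 := (LinearMap.range (gaugeU m : L2 →ₗ[ℂ] L2))ᗮ

lemma mem_gaugeCompl {m : ℕ} {f : L2} : f ∈ gaugeCompl m ↔ ∀ g, ⟪gaugeU m g, f⟫_ℂ = 0 := by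
  rw [gaugeCompl, Submodule.mem_orthogonal]
  exact ⟨fun h g => h _ ⟨g, rfl⟩, by rintro h _ ⟨g, rfl⟩; exact h g⟩

/-- Orthogonality of `f` to `conj Q_m hardyᗮ` means `Q_m f ∈ hardy`, and orthogonality to `Q_m
hardy` means `Q_m f ⊥ Q_{2m} hardy`. -/
lemma mem_gaugeCompl_iff {m : ℕ} {f : L2} : f ∈ gaugeCompl m ↔ mulQ m f ∈ modelSpace (2 * m) := by
  rw [mem_gaugeCompl, mem_modelSpace_iff]
  constructor
  · intro h
    constructor
    · refine mem_hardy_of_inner_eq_zero fun g hg => ?_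
      rw [← inner_mulQConj_left, ← gaugeU_of_mem_orthogonal m hg, h]
    · intro g hg
      rw [two_mul, ← mulQ_mulQ, inner_mulQ_left, mulQConj_mulQ, ← gaugeU_of_mem_hardy m hg, h]
  · rintro ⟨h1, h2⟩ g
    rw [gaugeU_apply, inner_add_left, inner_mulQConj_left,
      Submodule.inner_left_of_mem_orthogonal h1 (projNeg_mem g), add_zero]
    have h3 := h2 _ (projPos_mem_hardy g)
    rwa [two_mul, ← mulQ_mulQ, inner_mulQ_left, mulQConj_mulQ] at h3

instance (m : ℕ) : FiniteDimensional ℂ (gaugeCompl m) := by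
  have h : gaugeCompl m ≤ (modelSpace (2 * m)).map (mulQConj m : L2 →ₗ[ℂ] L2) := fun f hf =>
    ⟨mulQ m f, mem_gaugeCompl_iff.1 hf, mulQConj_mulQ m f⟩
  exact Submodule.finiteDimensional_of_le h

lemma gaugeCompl_orthogonal (m : ℕ) :
    (gaugeCompl m)ᗮ = LinearMap.range (gaugeU m : L2 →ₗ[ℂ] L2) := by
  have hc : IsClosed (LinearMap.range (gaugeU m : L2 →ₗ[ℂ] L2) : Set L2) := by
    have := (gaugeIsometry m).isometry.isClosedEmbedding.isClosed_range
    exact this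
  have : CompleteSpace (LinearMap.range (gaugeU m : L2 →ₗ[ℂ] L2)) := hc.completeSpace_coe
  exact Submodule.orthogonal_orthogonal _

/-! ### Weak derivatives in `L²` -/

/-- `g` is the weak derivative of `f`, tested against Schwartz functions. -/
def HasWeakDeriv (f g : L2) : Prop :=
  ∀ φ : SchwartzMap ℝ ℂ, (∫ x, deriv φ x * f x) + ∫ x, φ x * g x = 0

lemma integrable_schwartz_mul (φ : SchwartzMap ℝ ℂ) (f : L2) :
    Integrable (fun x => φ x * f x) :=
  (φ.memLp 2).integrable_mul (Lp.memLp f)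

lemma integrable_deriv_schwartz_mul (φ : SchwartzMap ℝ ℂ) (f : L2) :
    Integrable (fun x => deriv φ x * f x) :=
  integrable_schwartz_mul (SchwartzMap.derivCLM ℂ ℂ φ) f

lemma hasWeakDeriv_iff_derivCLM {f g : L2} :
    HasWeakDeriv f g ↔ TemperedDistribution.derivCLM ℂ (f : TemperedDistribution ℝ ℂ) = g := by
  have h : ∀ φ : SchwartzMap ℝ ℂ,
      TemperedDistribution.derivCLM ℂ (f : TemperedDistribution ℝ ℂ) φ =
        -∫ x, deriv φ x * f x := by
    intro φ
    rw [TemperedDistribution.derivCLM_apply_apply, Lp.toTemperedDistribution_apply,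
      ← integral_neg]
    refine integral_congr_ae (Filter.Eventually.of_forall fun x => ?_)
    simp
  constructor
  · intro hfg
    ext φ
    rw [h, Lp.toTemperedDistribution_apply]
    simp only [smul_eq_mul]
    linear_combination -hfg φ
  · intro hfg φ
    have h1 := h φ
    rw [hfg, Lp.toTemperedDistribution_apply] at h1
    simp only [smul_eq_mul] at h1
    rw [h1]; ring

lemma derivCLM_eq_lineDeriv (T : TemperedDistribution ℝ ℂ) :
    TemperedDistribution.derivCLM ℂ T = LineDeriv.lineDerivOp (1 : ℝ) T := by
  ext φ
  rw [TemperedDistribution.derivCLM_apply_apply, TemperedDistribution.lineDerivOp_apply_apply]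
  congr 2

/-- The Fourier transform is injective on tempered distributions and turns the derivative into
multiplication by `2π i ξ`. The function `ξ 𝓕 f` is a priori only locally integrable, so almost
everywhere equality is tested against smooth compactly supported functions. -/
lemma hasWeakDeriv_iff_fourier {f g : L2} :
    HasWeakDeriv f g ↔
      fourierL2 g =ᵐ[volume] fun ξ => (2 * Real.pi * Complex.I) * ξ * fourierL2 f ξ := by
  have hF : ∀ u : L2, (𝓕 (u : TemperedDistribution ℝ ℂ)) =
      ((fourierL2 u : L2) : TemperedDistribution ℝ ℂ) :=
    fun u => Lp.fourier_toTemperedDistribution_eq u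
  have hinj : Function.Injective (fun T : TemperedDistribution ℝ ℂ => 𝓕 T) :=
    Function.LeftInverse.injective (g := fun T : TemperedDistribution ℝ ℂ => 𝓕⁻ T)
      fun T => FourierTransform.fourierInv_fourier_eq T
  have hg : (fun x : ℝ => inner ℝ x (1 : ℝ)).HasTemperateGrowth := by fun_prop
  have hgc : (fun x : ℝ => ((inner ℝ x (1 : ℝ) : ℝ) : ℂ)).HasTemperateGrowth := by fun_prop
  have key : ∀ φ : SchwartzMap ℝ ℂ,
      ((2 * Real.pi * Complex.I) • TemperedDistribution.smulLeftCLM ℂ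
        (fun x : ℝ => ((inner ℝ x (1 : ℝ) : ℝ) : ℂ))
        ((fourierL2 f : L2) : TemperedDistribution ℝ ℂ)) φ =
      ∫ ξ, φ ξ * ((2 * Real.pi * Complex.I) * ξ * fourierL2 f ξ) := by
    intro φ
    change (2 * Real.pi * Complex.I) • ((TemperedDistribution.smulLeftCLM ℂ
        (fun x : ℝ => ((inner ℝ x (1 : ℝ) : ℝ) : ℂ))
        ((fourierL2 f : L2) : TemperedDistribution ℝ ℂ)) φ) = _
    rw [TemperedDistribution.smulLeftCLM_apply_apply, Lp.toTemperedDistribution_apply,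
      ← integral_smul]
    refine integral_congr_ae (Filter.Eventually.of_forall fun x => ?_)
    dsimp only
    rw [SchwartzMap.smulLeftCLM_apply_apply hgc]
    simp only [smul_eq_mul, RCLike.inner_apply, conj_trivial, one_mul]
    ring
  rw [hasWeakDeriv_iff_derivCLM, ← hinj.eq_iff, derivCLM_eq_lineDeriv]
  simp only [TemperedDistribution.fourier_lineDerivOp_eq, hF]
  constructor
  · intro h
    refine ae_eq_of_integral_contDiff_smul_eq
      ((Lp.memLp (fourierL2 g)).locallyIntegrable one_le_two) ?_ ?_
    · have h1 : LocallyIntegrable (fourierL2 f) volume :=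
        (Lp.memLp (fourierL2 f)).locallyIntegrable one_le_two
      have h2 : LocallyIntegrable
          (fun ξ : ℝ => ((2 * Real.pi * Complex.I) * (ξ : ℂ)) • fourierL2 f ξ) volume :=
        h1.continuous_smul (g := fun ξ : ℝ => (2 * Real.pi * Complex.I) * (ξ : ℂ)) (by fun_prop)
      exact h2
    · intro χ hχ hcpt
      have hg₁ : HasCompactSupport (Complex.ofRealCLM ∘ χ) := hcpt.comp_left rfl
      have hg₂ : ContDiff ℝ (⊤ : ℕ∞) (Complex.ofRealCLM ∘ χ) := by fun_prop
      have h3 := key (hg₁.toSchwartzMap hg₂)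
      have h4 : ((fourierL2 g : L2) : TemperedDistribution ℝ ℂ) (hg₁.toSchwartzMap hg₂) =
          ∫ x, χ x • fourierL2 g x := by
        rw [Lp.toTemperedDistribution_apply]
        rfl
      rw [← h4, ← h, h3]
      rfl
  · intro h
    ext φ
    rw [key, Lp.toTemperedDistribution_apply]
    refine integral_congr_ae ?_
    filter_upwards [h] with x hx
    rw [hx, smul_eq_mul]

/-- Test the weak derivative of `f` against `q φ`, which is again a Schwartz function because `q`
has temperate growth. -/
lemma HasWeakDeriv.mul {q q' : ℝ → ℂ} (hq : q.HasTemperateGrowth)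
    (hd : ∀ x, HasDerivAt q (q' x) x) {f g u v : L2} (h : HasWeakDeriv f g)
    (hu : (u : ℝ → ℂ) =ᵐ[volume] fun x => q x * f x)
    (hv : (v : ℝ → ℂ) =ᵐ[volume] fun x => q x * g x + q' x * f x) : HasWeakDeriv u v := by
  intro φ
  have h1 := h (SchwartzMap.smulLeftCLM ℂ q φ)
  have hfun : (SchwartzMap.smulLeftCLM ℂ q φ : ℝ → ℂ) = fun x => q x * φ x := by
    ext x; rw [SchwartzMap.smulLeftCLM_apply_apply hq, smul_eq_mul]
  have hder : ∀ x, deriv (SchwartzMap.smulLeftCLM ℂ q φ) x = q' x * φ x + q x * deriv φ x := by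
    intro x
    rw [hfun]
    exact ((hd x).mul (φ.differentiableAt.hasDerivAt)).deriv
  rw [← integral_add (integrable_deriv_schwartz_mul _ _) (integrable_schwartz_mul _ _)] at h1 ⊢
  rw [← h1]
  refine integral_congr_ae ?_
  filter_upwards [hu, hv] with x h2 h3
  rw [h2, h3, hder, SchwartzMap.smulLeftCLM_apply_apply hq, smul_eq_mul]
  ring

lemma HasWeakDeriv.projPos {f g : L2} (h : HasWeakDeriv f g) :
    HasWeakDeriv (projPos f) (projPos g) := by
  rw [hasWeakDeriv_iff_fourier] at *
  filter_upwards [h, fourierL2_projPos f, fourierL2_projPos g] with x h1 h2 h3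
  rw [h2, h3]
  by_cases h0 : x ∈ Set.Ici (0 : ℝ)
  · rw [Set.indicator_of_mem h0, Set.indicator_of_mem h0, h1]
  · rw [Set.indicator_of_notMem h0, Set.indicator_of_notMem h0, mul_zero]

lemma HasWeakDeriv.projNeg {f g : L2} (h : HasWeakDeriv f g) :
    HasWeakDeriv (projNeg f) (projNeg g) := by
  rw [hasWeakDeriv_iff_fourier] at *
  filter_upwards [h, fourierL2_projNeg f, fourierL2_projNeg g] with x h1 h2 h3
  rw [h2, h3]
  by_cases h0 : x ∈ Set.Iio (0 : ℝ)
  · rw [Set.indicator_of_mem h0, Set.indicator_of_mem h0, h1]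
  · rw [Set.indicator_of_notMem h0, Set.indicator_of_notMem h0, mul_zero]

/-- The symbols `2π i ξ` and `2π |ξ|` have the same modulus. Membership in `H¹` can thus be checked
with the product rule, which is not available for `|∇|` itself. -/
lemma exists_hasWeakDeriv_iff {f : L2} :
    (∃ g, HasWeakDeriv f g) ↔ f ∈ absNabla.domain := by
  change _ ↔ MemLp (fun ξ => ((2 * Real.pi * |ξ| : ℝ) : ℂ) * fourierL2 f ξ) 2 volume
  have hf := Lp.aestronglyMeasurable (fourierL2 f)
  constructor
  · rintro ⟨g, hg⟩
    rw [hasWeakDeriv_iff_fourier] at hg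
    refine (Lp.memLp (fourierL2 g)).mono (AEStronglyMeasurable.mul (by fun_prop) hf) ?_
    filter_upwards [hg] with x hx
    rw [hx]
    simp [abs_of_pos Real.pi_pos]
  · intro h
    have h1 : MemLp (fun ξ : ℝ => (2 * Real.pi * Complex.I) * ξ * fourierL2 f ξ) 2 volume := by
      refine h.mono (AEStronglyMeasurable.mul (by fun_prop) hf)
        (Filter.Eventually.of_forall fun x => ?_)
      simp [abs_of_pos Real.pi_pos]
    refine ⟨fourierL2.symm h1.toLp, ?_⟩
    rw [hasWeakDeriv_iff_fourier, LinearIsometryEquiv.apply_symm_apply]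
    exact h1.coeFn_toLp

/-! ### The graph of `|∇|` -/

/-- `f` is in the domain of `|∇|` and `|∇| f = g`. -/
def IsAbsNabla (f g : L2) : Prop :=
  fourierL2 g =ᵐ[volume] fun ξ => ((2 * Real.pi * |ξ| : ℝ) : ℂ) * fourierL2 f ξ

lemma isAbsNabla_absNabla (f : absNabla.domain) : IsAbsNabla f (absNabla f) := by
  have h : fourierL2 (absNabla f) =
      mulOp (fun ξ => ((2 * Real.pi * |ξ| : ℝ) : ℂ)) ⟨fourierL2 f, f.2⟩ :=
    fourierL2.apply_symm_apply _
  unfold IsAbsNabla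
  rw [h]
  exact coeFn_mulOp _ _

lemma IsAbsNabla.mem_domain {f g : L2} (h : IsAbsNabla f g) : f ∈ absNabla.domain :=
  mem_mulOp_domain_of_ae_eq (f := fourierL2 f) h

lemma IsAbsNabla.unique {f g g' : L2} (h : IsAbsNabla f g) (h' : IsAbsNabla f g') : g = g' :=
  fourierL2.injective (Lp.ext (h.trans h'.symm))

lemma IsAbsNabla.add {f g f' g' : L2} (h : IsAbsNabla f g) (h' : IsAbsNabla f' g') :
    IsAbsNabla (f + f') (g + g') := by
  unfold IsAbsNabla at *
  rw [map_add, map_add]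
  filter_upwards [h, h', Lp.coeFn_add (fourierL2 f) (fourierL2 f'),
    Lp.coeFn_add (fourierL2 g) (fourierL2 g')] with x h1 h2 h3 h4
  rw [h4, h3, Pi.add_apply, Pi.add_apply, h1, h2]; ring

/-- On nonnegative frequencies `|ξ| = ξ`, so `|∇|` is the local operator `-i d/dx`; on `hardyᗮ` the
sign is reversed. -/
lemma HasWeakDeriv.isAbsNabla_of_mem_hardy {f g : L2} (h : HasWeakDeriv f g) (hf : f ∈ hardy) :
    IsAbsNabla f ((-Complex.I) • g) := by
  rw [hasWeakDeriv_iff_fourier] at h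
  unfold IsAbsNabla
  rw [map_smul]
  filter_upwards [h, Lp.coeFn_smul (-Complex.I) (fourierL2 g), projPos_eq_self_iff.1 hf]
    with x h1 h2 h3
  rw [h2, Pi.smul_apply, h1, smul_eq_mul]
  rcases lt_or_ge x 0 with h0 | h0
  · rw [h3 h0]; simp
  · rw [abs_of_nonneg h0]
    push_cast
    linear_combination (-2 * Real.pi * x * fourierL2 f x : ℂ) * Complex.I_sq

lemma HasWeakDeriv.isAbsNabla_of_mem_orthogonal {f g : L2} (h : HasWeakDeriv f g)
    (hf : f ∈ hardyᗮ) : IsAbsNabla f (Complex.I • g) := by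
  rw [hasWeakDeriv_iff_fourier] at h
  unfold IsAbsNabla
  rw [map_smul]
  filter_upwards [h, Lp.coeFn_smul Complex.I (fourierL2 g),
    projPos_eq_zero_iff.1 (mem_hardy_orthogonal.1 hf)] with x h1 h2 h3
  rw [h2, Pi.smul_apply, h1, smul_eq_mul]
  rcases lt_or_ge x 0 with h0 | h0
  · rw [abs_of_neg h0]
    push_cast
    linear_combination (2 * Real.pi * x * fourierL2 f x : ℂ) * Complex.I_sq
  · rw [h3 h0]; simp

lemma inner_isAbsNabla {f f' g g' : L2} (h : IsAbsNabla f f') (h' : IsAbsNabla g g') :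
    ⟪f', g⟫_ℂ = ⟪f, g'⟫_ℂ := by
  rw [← fourierL2.inner_map_map, ← fourierL2.inner_map_map f, inner_L2, inner_L2]
  refine integral_congr_ae ?_
  filter_upwards [h, h'] with x h1 h2
  rw [h1, h2, map_mul, Complex.conj_ofReal]; ring

/-! ### Product rule with `Q` -/

/-- Writing `1 / (x + i)` as `(x - i) / (1 + x²)` leaves polynomials and a power of `1 + x²`, whose
temperate growth is known. -/
lemma hasTemperateGrowth_Q (m : ℕ) : (Q m).HasTemperateGrowth := by
  have h : Q m = (fun x : ℝ => Complex.I * (((x : ℂ) - Complex.I) * ((x : ℂ) - Complex.I) *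
      (((1 + ‖x‖ ^ 2) ^ (-1 : ℝ) : ℝ) : ℂ))) ^ m := by
    ext x
    have h1 : (1 + ‖x‖ ^ 2) ^ (-1 : ℝ) = (1 + x ^ 2)⁻¹ := by
      rw [Real.rpow_neg_one, Real.norm_eq_abs, sq_abs]
    have h2 : ((x : ℂ) - Complex.I) / ((x : ℂ) + Complex.I) =
        ((x : ℂ) - Complex.I) * ((x : ℂ) - Complex.I) * (((1 + x ^ 2)⁻¹ : ℝ) : ℂ) := by
      have hx := add_I_ne_zero x
      have h3 : (1 : ℂ) + x ^ 2 = (x + Complex.I) * (x - Complex.I) := by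
        linear_combination Complex.I_sq
      have h4 : (x : ℂ) - Complex.I ≠ 0 := by
        rw [← norm_ne_zero_iff, norm_sub_I]; exact norm_ne_zero_iff.2 hx
      push_cast
      rw [h3]
      field_simp
    rw [Pi.pow_apply, Q, h1, h2]
  rw [h]
  refine Function.HasTemperateGrowth.pow ?_ m
  have h5 := Function.hasTemperateGrowth_one_add_norm_sq_rpow ℝ (-1)
  fun_prop

lemma hasTemperateGrowth_conj_Q (m : ℕ) :
    (fun x => (starRingEnd ℂ) (Q m x)).HasTemperateGrowth :=
  Function.HasTemperateGrowth.comp (g := fun z : ℂ => (starRingEnd ℂ) z)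
    (Complex.conjCLE : ℂ →L[ℝ] ℂ).hasTemperateGrowth (hasTemperateGrowth_Q m)

/-- The logarithmic derivative of `(x - i) / (x + i)` is `2i / (1 + x²)`. This is where the
potential of `L₊` comes from. -/
lemma hasDerivAt_Q (m : ℕ) (x : ℝ) :
    HasDerivAt (Q m) (Complex.I * ((2 * m / (1 + x ^ 2) : ℝ) : ℂ) * Q m x) x := by
  have hx := add_I_ne_zero x
  have h4 : (x : ℂ) - Complex.I ≠ 0 := by
    rw [← norm_ne_zero_iff, norm_sub_I]; exact norm_ne_zero_iff.2 hx
  have h0 : HasDerivAt (fun x : ℝ => (x : ℂ)) 1 x := Complex.ofRealCLM.hasDerivAt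
  have h1 := (((h0.sub_const Complex.I).div (h0.add_const Complex.I) hx).const_mul
    Complex.I).pow m
  refine h1.congr_deriv ?_
  have h3 : (1 : ℂ) + x ^ 2 = (x + Complex.I) * (x - Complex.I) := by
    linear_combination Complex.I_sq
  rcases m with _ | k
  · simp
  · rw [Q, Nat.add_sub_cancel, pow_succ _ k, Pi.div_apply]
    push_cast
    rw [h3]
    field_simp
    ring

lemma hasDerivAt_conj_Q (m : ℕ) (x : ℝ) :
    HasDerivAt (fun x => (starRingEnd ℂ) (Q m x))
      (-Complex.I * ((2 * m / (1 + x ^ 2) : ℝ) : ℂ) * (starRingEnd ℂ) (Q m x)) x := by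
  have h := (Complex.conjCLE : ℂ →L[ℝ] ℂ).hasFDerivAt.comp_hasDerivAt x (hasDerivAt_Q m x)
  refine h.congr_deriv ?_
  change (starRingEnd ℂ) _ = _
  rw [map_mul, map_mul, Complex.conj_I, Complex.conj_ofReal]

lemma coeFn_potential (m : ℕ) (f : L2) :
    potential m f =ᵐ[volume] fun x => ((2 * m / (1 + x ^ 2) : ℝ) : ℂ) * f x :=
  coeFn_mulBdd _ _ _ _ f

lemma HasWeakDeriv.mulQ {f g : L2} (h : HasWeakDeriv f g) (m : ℕ) :
    HasWeakDeriv (mulQ m f) (mulQ m g + Complex.I • potential m (mulQ m f)) := by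
  refine h.mul (hasTemperateGrowth_Q m) (hasDerivAt_Q m) (coeFn_mulQ m f) ?_
  filter_upwards [Lp.coeFn_add (HalfHarmonic.mulQ m g)
      (Complex.I • potential m (HalfHarmonic.mulQ m f)),
    Lp.coeFn_smul Complex.I (potential m (HalfHarmonic.mulQ m f)),
    coeFn_potential m (HalfHarmonic.mulQ m f), coeFn_mulQ m f, coeFn_mulQ m g] with x h1 h2 h3 h4 h5
  rw [h1, Pi.add_apply, h2, Pi.smul_apply, h3, h4, h5, smul_eq_mul]; ring

lemma HasWeakDeriv.mulQConj {f g : L2} (h : HasWeakDeriv f g) (m : ℕ) :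
    HasWeakDeriv (mulQConj m f)
      (mulQConj m g + (-Complex.I) • potential m (mulQConj m f)) := by
  refine h.mul (hasTemperateGrowth_conj_Q m) (hasDerivAt_conj_Q m) (coeFn_mulQConj m f) ?_
  filter_upwards [Lp.coeFn_add (HalfHarmonic.mulQConj m g)
      ((-Complex.I) • potential m (HalfHarmonic.mulQConj m f)),
    Lp.coeFn_smul (-Complex.I) (potential m (HalfHarmonic.mulQConj m f)),
    coeFn_potential m (HalfHarmonic.mulQConj m f), coeFn_mulQConj m f, coeFn_mulQConj m g]
    with x h1 h2 h3 h4 h5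
  rw [h1, Pi.add_apply, h2, Pi.smul_apply, h3, h4, h5, smul_eq_mul]; ring

/-- The intertwining relation `(|∇| - 2 m / (1 + x ^ 2)) U f = U |∇| f`. -/
lemma IsAbsNabla.gaugeU {f g : L2} (h : IsAbsNabla f g) (m : ℕ) :
    IsAbsNabla (gaugeU m f) (gaugeU m g + potential m (gaugeU m f)) := by
  obtain ⟨d, hd⟩ := exists_hasWeakDeriv_iff.2 h.mem_domain
  have hp := hd.projPos
  have hn := hd.projNeg
  have hg : g = (-Complex.I) • projPos d + Complex.I • projNeg d := by
    refine h.unique ?_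
    have := (hp.isAbsNabla_of_mem_hardy (projPos_mem_hardy f)).add
      (hn.isAbsNabla_of_mem_orthogonal (projNeg_mem f))
    rwa [projPos_add_projNeg] at this
  have h1 := (hp.mulQ m).isAbsNabla_of_mem_hardy (mulQ_mem_hardy m (projPos_mem_hardy f))
  have h2 := (hn.mulQConj m).isAbsNabla_of_mem_orthogonal (mulQConj_mem m (projNeg_mem f))
  have h3 := h1.add h2
  rw [← gaugeU_apply] at h3
  convert h3 using 1
  rw [hg, map_add, map_smul, map_smul, gaugeU_of_mem_hardy m (projPos_mem_hardy d),
    gaugeU_of_mem_orthogonal m (projNeg_mem d), gaugeU_apply, map_add]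
  -- The terms `(-i)(i V)` on `hardy` and `i (-i V)` on `hardyᗮ` both equal `V`, so a single
  -- potential serves both halves.
  simp only [smul_add, smul_smul, neg_mul, mul_neg, Complex.I_mul_I, neg_neg, one_smul]
  abel

lemma mulQ_mem_domain {f : L2} (m : ℕ) (hf : f ∈ absNabla.domain) :
    mulQ m f ∈ absNabla.domain := by
  obtain ⟨d, hd⟩ := exists_hasWeakDeriv_iff.2 hf
  exact exists_hasWeakDeriv_iff.1 ⟨_, hd.mulQ m⟩

lemma mulQConj_mem_domain {f : L2} (m : ℕ) (hf : f ∈ absNabla.domain) :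
    mulQConj m f ∈ absNabla.domain := by
  obtain ⟨d, hd⟩ := exists_hasWeakDeriv_iff.2 hf
  exact exists_hasWeakDeriv_iff.1 ⟨_, hd.mulQConj m⟩

/-- The explicit left inverse is composed of Fourier projections and multiplications by `Q_m` and
its conjugate, all of which preserve `H¹`. This yields equality of domains and not only an
inclusion. -/
lemma gaugeU_mem_domain_iff {m : ℕ} {f : L2} :
    gaugeU m f ∈ absNabla.domain ↔ f ∈ absNabla.domain := by
  constructor
  · intro h
    obtain ⟨d, hd⟩ := exists_hasWeakDeriv_iff.2 h
    rw [← gaugeU_leftInverse m f]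
    exact absNabla.domain.add_mem
      (mulQConj_mem_domain m (exists_hasWeakDeriv_iff.1 ⟨_, hd.projPos⟩))
      (mulQ_mem_domain m (exists_hasWeakDeriv_iff.1 ⟨_, hd.projNeg⟩))
  · intro h
    exact ((isAbsNabla_absNabla ⟨f, h⟩).gaugeU m).mem_domain

lemma cauchy_zero_mem_domain : cauchy 0 ∈ absNabla.domain := by
  change MemLp (fun ξ => ((2 * Real.pi * |ξ| : ℝ) : ℂ) * fourierL2 (cauchy 0) ξ) 2 volume
  have hm : AEStronglyMeasurable
      (fun ξ => ((2 * Real.pi * |ξ| : ℝ) : ℂ) * fourierL2 (cauchy 0) ξ) volume :=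
    AEStronglyMeasurable.mul (by fun_prop) (Lp.aestronglyMeasurable _)
  rw [memLp_two_iff_integrable_sq_norm hm]
  -- With `E = exp (-π ξ)` the squared modulus is `(4 π² ξ E²)² = 16 π² E² (π ξ E)²`, where `π ξ E ≤
  -- 1` and `E²` is the value of `halfExp 0`.
  refine ((integrable_halfExp 0).norm.const_mul (16 * Real.pi ^ 2)).mono'
    (hm.norm.pow 2) ?_
  filter_upwards [coeFn_fourierL2_cauchy 0] with ξ h
  have hpi := Real.pi_pos
  rw [Real.norm_of_nonneg (by positivity), h, norm_mul, norm_mul, Complex.norm_real, halfExp]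
  by_cases hξ : ξ ∈ Set.Ioi (0 : ℝ)
  · have hpos : 0 < ξ := hξ
    rw [Set.indicator_of_mem hξ, Complex.norm_exp]
    have hre : ((-(2 * Real.pi * ((0 : ℕ) + 1) : ℝ) : ℂ) * ξ).re =
        -(Real.pi * ξ) + -(Real.pi * ξ) := by
      rw [← Complex.ofReal_neg, ← Complex.ofReal_mul, Complex.ofReal_re]; push_cast; ring
    rw [hre, Real.exp_add]
    set E := Real.exp (-(Real.pi * ξ))
    have hE : 0 < E := Real.exp_pos _
    have h1 : Real.pi * ξ * E ≤ 1 := by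
      have h2 : Real.exp (Real.pi * ξ) * E = 1 := by
        rw [← Real.exp_add, add_neg_cancel, Real.exp_zero]
      have h3 := Real.add_one_le_exp (Real.pi * ξ)
      nlinarith
    have h4 : (Real.pi * ξ * E) ^ 2 ≤ 1 := pow_le_one₀ (by positivity) h1
    have h5 : ‖(-(2 * Real.pi * Complex.I) : ℂ)‖ = 2 * Real.pi := by
      simp [abs_of_pos hpi]
    rw [h5, Real.norm_of_nonneg (by positivity), abs_of_pos hpos]
    calc (2 * Real.pi * ξ * (2 * Real.pi * (E * E))) ^ 2
        = 16 * Real.pi ^ 2 * (E * E) * (Real.pi * ξ * E) ^ 2 := by ring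
      _ ≤ 16 * Real.pi ^ 2 * (E * E) * 1 := by gcongr
      _ = _ := by ring
  · rw [Set.indicator_of_notMem hξ]; simp

lemma gaugeCompl_le_domain (m : ℕ) : gaugeCompl m ≤ absNabla.domain := by
  have h : modelSpace (2 * m) ≤ absNabla.domain := by
    refine Submodule.span_le.2 ?_
    rintro _ ⟨k, rfl⟩
    exact mulQ_mem_domain _ cauchy_zero_mem_domain
  intro f hf
  rw [← mulQConj_mulQ m f]
  exact mulQConj_mem_domain m (h (mem_gaugeCompl_iff.1 hf))

lemma dense_absNabla_domain : Dense (absNabla.domain : Set L2) := by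
  have h : Dense (Set.range (SchwartzMap.toLpCLM ℂ ℂ 2 (volume : Measure ℝ))) :=
    SchwartzMap.denseRange_toLpCLM ENNReal.ofNat_ne_top
  refine h.mono ?_
  rintro _ ⟨φ, rfl⟩
  refine exists_hasWeakDeriv_iff.1 ⟨(SchwartzMap.derivCLM ℂ ℂ φ).toLp 2, ?_⟩
  rw [hasWeakDeriv_iff_derivCLM, SchwartzMap.toLpCLM_apply, Lp.toTemperedDistribution_toLp_eq,
    Lp.toTemperedDistribution_toLp_eq, TemperedDistribution.derivCLM_toTemperedDistributionCLM_eq ℂ]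

/-! ### The operator `R` has finite rank -/

lemma conj_Q_mul_Q_of_le {k m : ℕ} (h : k ≤ m) (x : ℝ) :
    (starRingEnd ℂ) (Q k x) * Q m x = Q (m - k) x := by
  conv_lhs => rw [← Nat.add_sub_cancel' h, Q_add, ← mul_assoc, conj_Q_mul_Q, one_mul]

lemma norm_Q_one_sub_sq (x y : ℝ) :
    ‖Q 1 x - Q 1 y‖ ^ 2 = 4 * |x - y| ^ 2 / ((1 + x ^ 2) * (1 + y ^ 2)) := by
  have h1 : Q 1 x - Q 1 y =
      (-2 * ((x - y : ℝ) : ℂ)) / (((x : ℂ) + Complex.I) * ((y : ℂ) + Complex.I)) := by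
    have hx := add_I_ne_zero x
    have hy := add_I_ne_zero y
    rw [Q, Q, pow_one, pow_one]
    field_simp
    push_cast
    ring_nf
    simp only [Complex.I_sq]
    ring
  rw [h1, norm_div, norm_mul, norm_mul, Complex.norm_real, div_pow, mul_pow, mul_pow,
    norm_add_I_sq, norm_add_I_sq, Real.norm_eq_abs]
  norm_num

lemma Q_eq_pow (m : ℕ) (x : ℝ) : Q m x = Q 1 x ^ m := by rw [Q, Q, pow_one]

/-- With `w = Q_1(x) conj Q_1(y)` the difference is `Q_m(y) (w ^ m - 1)`, and `w ^ m - 1` factors as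
a geometric sum. -/
lemma norm_Q_sub (m : ℕ) (x y : ℝ) :
    ‖Q m x - Q m y‖ =
      ‖Q 1 x - Q 1 y‖ * ‖∑ i ∈ Finset.range m, Q i x * (starRingEnd ℂ) (Q i y)‖ := by
  set w := Q 1 x * (starRingEnd ℂ) (Q 1 y)
  have hw : ∀ k, Q k x * (starRingEnd ℂ) (Q k y) = w ^ k := fun k => by
    rw [Q_eq_pow k x, Q_eq_pow k y, map_pow, mul_pow]
  have h : ∀ k, Q k x - Q k y = Q k y * (w ^ k - 1) := fun k => by
    rw [← hw]; linear_combination (-Q k x) * conj_Q_mul_Q k y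
  simp only [hw]
  have h1 := h 1
  rw [pow_one] at h1
  rw [h m, h1, ← geom_sum_mul, norm_mul, norm_mul, norm_mul, norm_Q, norm_Q]
  ring

/-- The functions `Q_j conj(Q_k) / (1 + x ^ 2)`. -/
def ratFun (p : ℕ × ℕ) (x : ℝ) : ℂ :=
  Q p.1 x * (starRingEnd ℂ) (Q p.2 x) * (((1 + x ^ 2)⁻¹ : ℝ) : ℂ)

lemma memLp_ratFun (p : ℕ × ℕ) : MemLp (ratFun p) 2 := by
  refine memLp_weight.mono ?_ (Filter.Eventually.of_forall fun x => ?_)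
  · have h1 := measurable_Q p.1
    have h2 := Complex.continuous_conj.measurable.comp (measurable_Q p.2)
    refine ((h1.mul h2).mul ?_).aestronglyMeasurable
    fun_prop
  · rw [ratFun, norm_mul, norm_mul, Complex.norm_conj, norm_Q, norm_Q, Complex.norm_real]
    simp

/-- The functions `Q_j conj(Q_k) / (1 + x ^ 2)` in `L²`. -/
def rat (p : ℕ × ℕ) : L2 := (memLp_ratFun p).toLp

lemma coeFn_rat (p : ℕ × ℕ) : rat p =ᵐ[volume] ratFun p := MemLp.coeFn_toLp _

/-- The factor `|Q_1(x) - Q_1(y)|²` equals `4 |x - y|² / ((1 + x²)(1 + y²))` and cancels the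
singular denominator; the squared geometric sum expands into separated variables. The null diagonal
is excluded because there `kernelR` takes the default value `0` of a division by zero. -/
lemma kernelR_eq_sum (m : ℕ) {x y : ℝ} (hxy : y ≠ x) :
    (kernelR m x y : ℂ) = ∑ p ∈ Finset.range m ×ˢ Finset.range m,
      (2 / Real.pi) * ratFun p x * (starRingEnd ℂ) (ratFun p y) := by
  have hd : |x - y| ≠ 0 := abs_ne_zero.2 (sub_ne_zero.2 hxy.symm)
  have hpi := Real.pi_ne_zero
  have hx : (1 + x ^ 2) ≠ 0 := by positivity
  have hy : (1 + y ^ 2) ≠ 0 := by positivity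
  set S := ∑ i ∈ Finset.range m, Q i x * (starRingEnd ℂ) (Q i y) with hS
  have h1 : kernelR m x y = (2 / Real.pi) * ((1 + x ^ 2)⁻¹ * (1 + y ^ 2)⁻¹) * ‖S‖ ^ 2 := by
    rw [kernelR, norm_Q_sub, mul_pow, norm_Q_one_sub_sq]
    field_simp
    ring
  have h2 : ((‖S‖ ^ 2 : ℝ) : ℂ) = S * (starRingEnd ℂ) S := by
    rw [Complex.mul_conj, Complex.normSq_eq_norm_sq]
  rw [h1, Complex.ofReal_mul, h2, hS, map_sum, Finset.sum_mul_sum, ← Finset.sum_product',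
    Finset.mul_sum]
  refine Finset.sum_congr rfl fun p _ => ?_
  simp only [ratFun, map_mul, Complex.conj_conj, Complex.conj_ofReal]
  push_cast
  ring

lemma integralR_eq_sum (m : ℕ) (f : L2) (x : ℝ) :
    integralR m f x = ∑ p ∈ Finset.range m ×ˢ Finset.range m,
      ((2 / Real.pi) * ⟪rat p, f⟫_ℂ) * ratFun p x := by
  have hne : ∀ᵐ y : ℝ, y ≠ x := by simp [ae_iff]
  have hae : ∀ᵐ y : ℝ, (kernelR m x y : ℂ) * f y =
      ∑ p ∈ Finset.range m ×ˢ Finset.range m,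
        ((2 / Real.pi) * ratFun p x) * ((starRingEnd ℂ) (rat p y) * f y) := by
    have hall : ∀ᵐ y : ℝ, ∀ p : ℕ × ℕ, rat p y = ratFun p y := ae_all_iff.2 coeFn_rat
    filter_upwards [hne, hall] with y h1 h2
    rw [kernelR_eq_sum m h1, Finset.sum_mul]
    refine Finset.sum_congr rfl fun p _ => ?_
    rw [h2]; ring
  rw [integralR, integral_congr_ae hae, integral_finsetSum]
  · refine Finset.sum_congr rfl fun p _ => ?_
    rw [integral_const_mul, inner_L2]; ring
  · intro p _
    exact ((Lp.memLp (rat p)).star.integrable_mul (Lp.memLp f)).const_mul _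

lemma opR_eq_sum (m : ℕ) (f : L2) :
    opR m f = ∑ p ∈ Finset.range m ×ˢ Finset.range m,
      ((2 / Real.pi) * ⟪rat p, f⟫_ℂ) • rat p := by
  have hsum : ∀ s : Finset (ℕ × ℕ),
      ((∑ p ∈ s, ((2 / Real.pi) * ⟪rat p, f⟫_ℂ) • rat p : L2) : ℝ → ℂ) =ᵐ[volume]
        fun x => ∑ p ∈ s, ((2 / Real.pi) * ⟪rat p, f⟫_ℂ) * ratFun p x := by
    intro s
    induction s using Finset.cons_induction with
    | empty =>
      filter_upwards [Lp.coeFn_zero ℂ 2 (volume : Measure ℝ)] with x hx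
      simp only [Finset.sum_empty]
      rw [hx]; rfl
    | cons a s ha ih =>
      simp only [Finset.sum_cons]
      filter_upwards [ih, Lp.coeFn_add (((2 / Real.pi) * ⟪rat a, f⟫_ℂ) • rat a)
        (∑ p ∈ s, ((2 / Real.pi) * ⟪rat p, f⟫_ℂ) • rat p),
        Lp.coeFn_smul ((2 / Real.pi) * ⟪rat a, f⟫_ℂ) (rat a), coeFn_rat a] with x h1 h2 h3 h4
      rw [h2, Pi.add_apply, h1, h3, Pi.smul_apply, h4, smul_eq_mul]
  refine Lp.ext ?_
  have h0 : (opR m f : ℝ → ℂ) =ᵐ[volume] integralR m f := MemLp.coeFn_toLp (memLp_integralR m f)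
  filter_upwards [h0, hsum (Finset.range m ×ˢ Finset.range m)] with x h1 h2
  rw [h1, h2, integralR_eq_sum]

lemma inner_opR_left (m : ℕ) (f g : L2) : ⟪opR m f, g⟫_ℂ = ⟪f, opR m g⟫_ℂ := by
  rw [opR_eq_sum, opR_eq_sum, sum_inner, inner_sum]
  refine Finset.sum_congr rfl fun p _ => ?_
  rw [inner_smul_left, inner_smul_right, map_mul, inner_conj_symm, map_div₀, map_ofNat,
    Complex.conj_ofReal]
  ring

/-- Multiplication by `Q_m` turns `Q_j conj Q_k / (1 + x²)` into `Q_{l+1} / (1 + x²)` with `l + 1 =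
m - k + j < 2m`. From `1 / (1 + x²) = (1 / 2i) (1 / (x - i) - 1 / (x + i))` and `Q_1 / (x - i) = i /
(x + i)` this is a combination of two spanning functions of the model space. -/
lemma rat_mem_gaugeCompl {m : ℕ} {p : ℕ × ℕ} (h1 : p.1 < m) (h2 : p.2 < m) :
    rat p ∈ gaugeCompl m := by
  obtain ⟨j, k⟩ := p
  dsimp only at h1 h2
  rw [mem_gaugeCompl_iff]
  set l := m - k - 1 + j with hl
  have h : mulQ m (rat (j, k)) = (Complex.I / 2) • mulQ (l + 1) (cauchy 0) +
      (1 / 2 : ℂ) • mulQ l (cauchy 0) := by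
    refine Lp.ext ?_
    filter_upwards [coeFn_mulQ m (rat (j, k)), coeFn_rat (j, k), coeFn_mulQ (l + 1) (cauchy 0),
      coeFn_mulQ l (cauchy 0), coeFn_cauchy 0, Lp.coeFn_add
        ((Complex.I / 2) • mulQ (l + 1) (cauchy 0)) ((1 / 2 : ℂ) • mulQ l (cauchy 0)),
      Lp.coeFn_smul (Complex.I / 2) (mulQ (l + 1) (cauchy 0)),
      Lp.coeFn_smul (1 / 2 : ℂ) (mulQ l (cauchy 0))] with x e1 e2 e3 e4 e5 e6 e7 e8
    rw [e1, e2, e6, Pi.add_apply, e7, e8, Pi.smul_apply, Pi.smul_apply, e3, e4, e5, ratFun,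
      cauchyFun, smul_eq_mul, smul_eq_mul]
    have h3 : Q m x * (Q j x * (starRingEnd ℂ) (Q k x) * (((1 + x ^ 2)⁻¹ : ℝ) : ℂ)) =
        Q (l + 1) x * (((1 + x ^ 2)⁻¹ : ℝ) : ℂ) := by
      rw [show l + 1 = (m - k) + j by omega, Q_add (m - k) j, ← conj_Q_mul_Q_of_le h2.le]; ring
    rw [h3, Q_add l 1, Q_eq_pow 1 x, pow_one]
    have hx := add_I_ne_zero x
    have h4 : (x : ℂ) - Complex.I ≠ 0 := by
      rw [← norm_ne_zero_iff, norm_sub_I]; exact norm_ne_zero_iff.2 hx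
    have h5 : (1 : ℂ) + x ^ 2 = (x + Complex.I) * (x - Complex.I) := by
      linear_combination Complex.I_sq
    have h6 : Q 1 x = Complex.I * (((x : ℂ) - Complex.I) / ((x : ℂ) + Complex.I)) := pow_one _
    rw [h6]
    push_cast
    rw [h5, zero_add, one_mul]
    field_simp
    linear_combination (Q l x * (-(x : ℂ) + Complex.I)) * Complex.I_sq
  rw [h]
  exact Submodule.add_mem _
    (Submodule.smul_mem _ _ (mulQ_cauchy_mem_modelSpace (by omega)))
    (Submodule.smul_mem _ _ (mulQ_cauchy_mem_modelSpace (by omega)))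

lemma opR_gaugeU (m : ℕ) (f : L2) : opR m (gaugeU m f) = 0 := by
  rw [opR_eq_sum]
  refine Finset.sum_eq_zero fun p hp => ?_
  rw [Finset.mem_product, Finset.mem_range, Finset.mem_range] at hp
  have h := mem_gaugeCompl.1 (rat_mem_gaugeCompl hp.1 hp.2) f
  rw [← inner_conj_symm, h, map_zero, mul_zero, zero_smul]

/-! ### `L₊` and `L₋` -/

lemma Lplus_eq {m : ℕ} {f g : L2} (h : IsAbsNabla f g) (hf : f ∈ (Lplus m).domain) :
    Lplus m ⟨f, hf⟩ = g - potential m f := by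
  change absNabla ⟨f, hf⟩ - potential m f = _
  rw [(isAbsNabla_absNabla ⟨f, hf⟩).unique h]

lemma Lminus_eq {m : ℕ} {f g : L2} (h : IsAbsNabla f g) (hf : f ∈ (Lminus m).domain) :
    Lminus m ⟨f, hf⟩ = g - potential m f + opR m f := by
  change absNabla ⟨f, hf⟩ - potential m f + opR m f = _
  rw [(isAbsNabla_absNabla ⟨f, hf⟩).unique h]

lemma inner_potential_left (m : ℕ) (f g : L2) : ⟪potential m f, g⟫_ℂ = ⟪f, potential m g⟫_ℂ := by
  rw [inner_L2, inner_L2]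
  refine integral_congr_ae ?_
  filter_upwards [coeFn_potential m f, coeFn_potential m g] with x h1 h2
  rw [h1, h2, map_mul, Complex.conj_ofReal]; ring

lemma Lplus_symm {m : ℕ} (f g : (Lplus m).domain) :
    ⟪Lplus m f, (g : L2)⟫_ℂ = ⟪(f : L2), Lplus m g⟫_ℂ := by
  have hf := isAbsNabla_absNabla ⟨f, f.2⟩
  have hg := isAbsNabla_absNabla ⟨g, g.2⟩
  rw [Lplus_eq hf f.2, Lplus_eq hg g.2, inner_sub_left, inner_sub_right, inner_potential_left,
    inner_isAbsNabla hf hg]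

lemma Lminus_symm {m : ℕ} (f g : (Lminus m).domain) :
    ⟪Lminus m f, (g : L2)⟫_ℂ = ⟪(f : L2), Lminus m g⟫_ℂ := by
  have hf := isAbsNabla_absNabla ⟨f, f.2⟩
  have hg := isAbsNabla_absNabla ⟨g, g.2⟩
  rw [Lminus_eq hf f.2, Lminus_eq hg g.2, inner_add_left, inner_add_right, inner_sub_left,
    inner_sub_right, inner_potential_left, inner_isAbsNabla hf hg, inner_opR_left]

lemma Lplus_gaugeU {m : ℕ} {f g : L2} (h : IsAbsNabla f g)
    (hf : gaugeU m f ∈ (Lplus m).domain) : Lplus m ⟨gaugeU m f, hf⟩ = gaugeU m g := by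
  rw [Lplus_eq (h.gaugeU m), add_sub_cancel_right]

lemma Lminus_gaugeU {m : ℕ} {f g : L2} (h : IsAbsNabla f g)
    (hf : gaugeU m f ∈ (Lminus m).domain) : Lminus m ⟨gaugeU m f, hf⟩ = gaugeU m g := by
  rw [Lminus_eq (h.gaugeU m), add_sub_cancel_right, opR_gaugeU, add_zero]

/-! ### The spectral resolution of `|∇|` -/

/-- The symbol `2 π |ξ|` of `|∇|`. -/
def freq (ξ : ℝ) : ℝ := 2 * Real.pi * |ξ|

lemma measurable_freq : Measurable freq := by unfold freq; fun_prop

lemma freq_nonneg (ξ : ℝ) : 0 ≤ freq ξ := by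
  have := Real.pi_pos
  unfold freq; positivity

/-- On each half-line `freq` is a nonzero multiple of `ξ`. Both the absolute continuity of the
spectrum of `|∇|` and the absence of eigenvalues rest on this. -/
lemma volume_freq_preimage {B : Set ℝ} (hB : volume B = 0) : volume (freq ⁻¹' B) = 0 := by
  have hpi := Real.pi_pos
  refine measure_mono_null (t := ((2 * Real.pi) * ·) ⁻¹' B ∪ ((-(2 * Real.pi)) * ·) ⁻¹' B) ?_ ?_
  · intro ξ hξ
    rcases abs_choice ξ with h | h
    · left
      simpa [freq, h] using hξ
    · right
      simpa [freq, h] using hξ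
  · rw [measure_union_null_iff, Real.volume_preimage_mul_left (by positivity),
      Real.volume_preimage_mul_left (neg_ne_zero.2 (by positivity))]
    simp [hB]

lemma norm_sq_eq_integral (f : L2) : ‖f‖ ^ 2 = ∫ x, ‖f x‖ ^ 2 := by
  have h : ((‖f‖ ^ 2 : ℝ) : ℂ) = ((∫ x, ‖f x‖ ^ 2 : ℝ) : ℂ) := by
    have h1 := inner_self_eq_norm_sq_to_K (𝕜 := ℂ) f
    rw [inner_L2] at h1
    rw [← integral_complex_ofReal]
    push_cast
    refine Eq.trans h1.symm ?_
    refine integral_congr_ae (Filter.Eventually.of_forall fun x => ?_)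
    dsimp only
    rw [← Complex.normSq_eq_conj_mul_self, Complex.normSq_eq_norm_sq]
    push_cast; rfl
  exact_mod_cast h

lemma integrable_norm_sq (f : L2) : Integrable (fun x => ‖f x‖ ^ 2) :=
  (memLp_two_iff_integrable_sq_norm (Lp.aestronglyMeasurable f)).1 (Lp.memLp f)

open Classical in
/-- The spectral projections of `|∇|`. -/
def freqProj (B : Set ℝ) : L2 →L[ℂ] L2 :=
  if hB : MeasurableSet B then
    (fourierL2.symm.toContinuousLinearEquiv : L2 →L[ℂ] L2) ∘L
      mulBdd ((freq ⁻¹' B).indicator 1) (measurable_one.indicator (measurable_freq hB)) 1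
        (fun x => (norm_indicator_le_norm_self _ x).trans (by simp)) ∘L
      (fourierL2.toContinuousLinearEquiv : L2 →L[ℂ] L2)
  else 0

lemma fourierL2_freqProj {B : Set ℝ} (hB : MeasurableSet B) (f : L2) :
    fourierL2 (freqProj B f) =ᵐ[volume] (freq ⁻¹' B).indicator (fourierL2 f) := by
  have h : fourierL2 (freqProj B f) = mulBdd ((freq ⁻¹' B).indicator 1)
      (measurable_one.indicator (measurable_freq hB)) 1
      (fun x => (norm_indicator_le_norm_self _ x).trans (by simp)) (fourierL2 f) := by
    rw [freqProj, dif_pos hB]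
    exact fourierL2.apply_symm_apply _
  rw [h]
  filter_upwards [coeFn_mulBdd ((freq ⁻¹' B).indicator 1)
      (measurable_one.indicator (measurable_freq hB)) 1
      (fun x => (norm_indicator_le_norm_self _ x).trans (by simp)) (fourierL2 f)] with x hx
  rw [hx]
  by_cases h0 : x ∈ freq ⁻¹' B
  · rw [Set.indicator_of_mem h0, Set.indicator_of_mem h0, Pi.one_apply, one_mul]
  · rw [Set.indicator_of_notMem h0, Set.indicator_of_notMem h0, zero_mul]

lemma freqProj_inter_apply {B C : Set ℝ} (hB : MeasurableSet B) (hC : MeasurableSet C) (f : L2) :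
    freqProj (B ∩ C) f = freqProj B (freqProj C f) := by
  refine fourierL2.injective (Lp.ext ?_)
  filter_upwards [fourierL2_freqProj (hB.inter hC) f, fourierL2_freqProj hC f,
    fourierL2_freqProj hB (freqProj C f)] with x h1 h2 h3
  rw [h1, h3]
  by_cases h4 : freq x ∈ B <;> by_cases h5 : freq x ∈ C <;> simp [Set.indicator, h2, h4, h5]

lemma inner_freqProj_left {B : Set ℝ} (hB : MeasurableSet B) (f g : L2) :
    ⟪freqProj B f, g⟫_ℂ = ⟪f, freqProj B g⟫_ℂ := by
  rw [← fourierL2.inner_map_map, ← fourierL2.inner_map_map f, inner_L2, inner_L2]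
  refine integral_congr_ae ?_
  filter_upwards [fourierL2_freqProj hB f, fourierL2_freqProj hB g] with x h1 h2
  rw [h1, h2]
  by_cases h0 : x ∈ freq ⁻¹' B
  · rw [Set.indicator_of_mem h0, Set.indicator_of_mem h0]
  · rw [Set.indicator_of_notMem h0, Set.indicator_of_notMem h0, map_zero, zero_mul, mul_zero]

lemma norm_freqProj_sq {B : Set ℝ} (hB : MeasurableSet B) (f : L2) :
    ‖freqProj B f‖ ^ 2 = ∫ ξ in freq ⁻¹' B, ‖fourierL2 f ξ‖ ^ 2 := by
  rw [← fourierL2.norm_map, norm_sq_eq_integral, ← integral_indicator (measurable_freq hB)]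
  refine integral_congr_ae ?_
  filter_upwards [fourierL2_freqProj hB f] with x h1
  rw [h1]
  by_cases h0 : x ∈ freq ⁻¹' B
  · rw [Set.indicator_of_mem h0, Set.indicator_of_mem h0]
  · rw [Set.indicator_of_notMem h0, Set.indicator_of_notMem h0, norm_zero]; simp

/-- By Pythagoras the squared distance from `v` to a partial sum is `‖v‖²` minus the partial sum of
the `‖u n‖²`. Strong additivity of spectral projections thus reduces to additivity of a scalar
integral. -/
lemma hasSum_of_pairwise_orthogonal {H : Type*} [NormedAddCommGroup H] [InnerProductSpace ℂ H]
    {u : ℕ → H} {v : H} (h1 : ∀ n, ⟪u n, v⟫_ℂ = ((‖u n‖ ^ 2 : ℝ) : ℂ))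
    (h2 : Pairwise fun i j => ⟪u i, u j⟫_ℂ = 0)
    (h3 : HasSum (fun n => ‖u n‖ ^ 2) (‖v‖ ^ 2)) : HasSum u v := by
  have key : ∀ s : Finset ℕ, ‖(∑ n ∈ s, u n) - v‖ ^ 2 = ‖v‖ ^ 2 - ∑ n ∈ s, ‖u n‖ ^ 2 := by
    intro s
    have hss : ‖∑ n ∈ s, u n‖ ^ 2 = ∑ n ∈ s, ‖u n‖ ^ 2 := by
      have h4 : ⟪∑ n ∈ s, u n, ∑ n ∈ s, u n⟫_ℂ = ((∑ n ∈ s, ‖u n‖ ^ 2 : ℝ) : ℂ) := by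
        rw [sum_inner, Complex.ofReal_sum]
        refine Finset.sum_congr rfl fun i hi => ?_
        rw [inner_sum, Finset.sum_eq_single_of_mem i hi fun j _ hj => h2 hj.symm,
          inner_self_eq_norm_sq_to_K]
        push_cast; rfl
      rw [inner_self_eq_norm_sq_to_K] at h4
      refine Complex.ofReal_injective (Eq.trans ?_ h4)
      push_cast; rfl
    have hsv : RCLike.re ⟪∑ n ∈ s, u n, v⟫_ℂ = ∑ n ∈ s, ‖u n‖ ^ 2 := by
      rw [sum_inner, Finset.sum_congr rfl fun n _ => h1 n, ← Complex.ofReal_sum]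
      exact Complex.ofReal_re _
    rw [@norm_sub_sq ℂ, hss, hsv]; ring
  rw [HasSum, tendsto_iff_norm_sub_tendsto_zero]
  have h4 : Filter.Tendsto (fun s : Finset ℕ => ‖(∑ n ∈ s, u n) - v‖ ^ 2)
      Filter.atTop (nhds 0) := by
    simp only [key]
    have := (tendsto_const_nhds (x := ‖v‖ ^ 2)).sub h3
    rwa [sub_self] at this
  have h5 := h4.sqrt
  simpa [Real.sqrt_sq] using h5

lemma hasSum_freqProj {B : ℕ → Set ℝ} (hB : ∀ n, MeasurableSet (B n))
    (hd : Pairwise (Function.onFun Disjoint B)) (f : L2) :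
    HasSum (fun n => freqProj (B n) f) (freqProj (⋃ n, B n) f) := by
  have hU := MeasurableSet.iUnion hB
  refine hasSum_of_pairwise_orthogonal (fun n => ?_) (fun i j hij => ?_) ?_
  · rw [inner_freqProj_left (hB n), ← freqProj_inter_apply (hB n) hU,
      Set.inter_eq_left.2 (Set.subset_iUnion B n)]
    have h := freqProj_inter_apply (hB n) (hB n) f
    rw [Set.inter_self] at h
    rw [h, ← inner_freqProj_left (hB n), inner_self_eq_norm_sq_to_K, ← h]
    push_cast; rfl
  · have h0 : freqProj ∅ f = 0 := by
      have := norm_freqProj_sq MeasurableSet.empty f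
      simpa using this
    change ⟪freqProj (B i) f, freqProj (B j) f⟫_ℂ = 0
    rw [inner_freqProj_left (hB i), ← freqProj_inter_apply (hB i) (hB j),
      Set.disjoint_iff_inter_eq_empty.1 (hd hij), h0, inner_zero_right]
  · simp only [norm_freqProj_sq (hB _), norm_freqProj_sq hU, Set.preimage_iUnion]
    exact hasSum_integral_iUnion (fun n => measurable_freq (hB n))
      (fun i j hij => (hd hij).preimage freq) (integrable_norm_sq _).integrableOn

/-- The spectral resolution of `|∇|`. -/
def freqPVM : ProjectionValuedMeasure L2 where
  proj := freqProj
  isStarProjection B hB := by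
    refine ⟨?_, ?_⟩
    · ext1 f
      have := freqProj_inter_apply hB hB f
      rw [Set.inter_self] at this
      exact this.symm
    · rw [ContinuousLinearMap.isSelfAdjoint_iff_isSymmetric]
      exact fun f g => inner_freqProj_left hB f g
  proj_empty := by
    ext1 f
    have := norm_freqProj_sq MeasurableSet.empty f
    simpa using this
  proj_univ := by
    ext1 f
    refine fourierL2.injective (Lp.ext ?_)
    filter_upwards [fourierL2_freqProj MeasurableSet.univ f] with x h
    rw [h]; simp
  proj_inter B C hB hC := by
    ext1 f
    exact freqProj_inter_apply hB hC f
  proj_iUnion B hB hd f := hasSum_freqProj hB hd f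

/-- The spectral measure is the image of `|𝓕 f|² dξ` under the symbol, so integrals against it
become integrals over frequencies. -/
lemma scalarMeasure_freqPVM (f : L2) :
    freqPVM.scalarMeasure f =
      (volume.withDensity fun ξ => ‖fourierL2 f ξ‖ₑ ^ 2).map freq := by
  refine Measure.ext fun B hB => ?_
  rw [freqPVM.scalarMeasure_apply f hB, Measure.map_apply measurable_freq hB,
    withDensity_apply _ (measurable_freq hB)]
  change ENNReal.ofReal (‖freqProj B f‖ ^ 2) = _
  rw [norm_freqProj_sq hB, ofReal_integral_eq_lintegral_ofReal
    (integrable_norm_sq _).integrableOn (Filter.Eventually.of_forall fun _ => by positivity)]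
  refine lintegral_congr fun ξ => ?_
  rw [ENNReal.ofReal_pow (norm_nonneg _), ofReal_norm]

lemma scalarMeasure_freqPVM_ac (f : L2) : freqPVM.scalarMeasure f ≪ volume := by
  rw [scalarMeasure_freqPVM]
  refine Measure.AbsolutelyContinuous.mk fun B hB h0 => ?_
  rw [Measure.map_apply measurable_freq hB]
  exact withDensity_absolutelyContinuous _ _ (volume_freq_preimage h0)

lemma measurable_enorm_sq (f : L2) : Measurable fun ξ => ‖f ξ‖ₑ ^ 2 :=
  (Lp.stronglyMeasurable f).measurable.enorm.pow_const 2

lemma freqPVM_represents : freqPVM.Represents absNabla := by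
  constructor
  · intro f
    change MemLp (fun ξ => ((2 * Real.pi * |ξ| : ℝ) : ℂ) * fourierL2 f ξ) 2 volume ↔ _
    have hm : AEStronglyMeasurable
        (fun ξ => ((2 * Real.pi * |ξ| : ℝ) : ℂ) * fourierL2 f ξ) volume :=
      AEStronglyMeasurable.mul (by fun_prop) (Lp.aestronglyMeasurable _)
    rw [scalarMeasure_freqPVM, lintegral_map (by fun_prop) measurable_freq,
      lintegral_withDensity_eq_lintegral_mul _ (measurable_enorm_sq _)
        ((measurable_freq.pow_const 2).ennreal_ofReal),
      memLp_two_iff_integrable_sq_norm hm, Integrable, hasFiniteIntegral_iff_enorm]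
    have h : ∀ ξ, ‖‖((2 * Real.pi * |ξ| : ℝ) : ℂ) * fourierL2 f ξ‖ ^ 2‖ₑ =
        ((fun ξ => ‖fourierL2 f ξ‖ₑ ^ 2) * fun ξ => ENNReal.ofReal (freq ξ ^ 2)) ξ := by
      intro ξ
      rw [Pi.mul_apply, enorm_pow, enorm_norm, enorm_mul, mul_pow, mul_comm,
        ENNReal.ofReal_pow (freq_nonneg ξ), ← ofReal_norm ((2 * Real.pi * |ξ| : ℝ) : ℂ),
        Complex.norm_real,
        Real.norm_of_nonneg (show 0 ≤ 2 * Real.pi * |ξ| from freq_nonneg ξ)]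
      rfl
    simp only [h]
    exact ⟨fun h => h.2, fun h => ⟨hm.norm.pow 2, h⟩⟩
  · intro f
    have h := isAbsNabla_absNabla f
    rw [scalarMeasure_freqPVM, integral_map measurable_freq.aemeasurable (by fun_prop)]
    have h1 : (fun ξ => ‖fourierL2 (f : L2) ξ‖ₑ ^ 2) =
        fun ξ => ((‖fourierL2 (f : L2) ξ‖₊ ^ 2 : NNReal) : ℝ≥0∞) := by
      ext ξ; rw [enorm_eq_nnnorm]; push_cast; rfl
    rw [h1, integral_withDensity_eq_integral_smul
      ((Lp.stronglyMeasurable (fourierL2 (f : L2))).measurable.nnnorm.pow_const 2),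
      ← fourierL2.inner_map_map, inner_L2, ← integral_complex_ofReal]
    refine integral_congr_ae ?_
    filter_upwards [h] with ξ h2
    rw [h2]
    have h3 : (‖fourierL2 (f : L2) ξ‖₊ ^ 2) • freq ξ = ‖fourierL2 (f : L2) ξ‖ ^ 2 * freq ξ := rfl
    rw [h3]
    have h4 : ((‖fourierL2 (f : L2) ξ‖ ^ 2 : ℝ) : ℂ) =
        (starRingEnd ℂ) (fourierL2 (f : L2) ξ) * fourierL2 (f : L2) ξ := by
      rw [← Complex.normSq_eq_conj_mul_self, Complex.normSq_eq_norm_sq]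
    refine Eq.trans ?_ (Complex.ofReal_mul _ _).symm
    rw [h4, freq]; ring

/-! ### Eigenvalues and resolvent of `|∇|` -/

/-- The transform `𝓕 f` is supported on a level set of the symbol, which is null. -/
lemma IsAbsNabla.eq_zero_of_eigen {f : L2} {z : ℂ} (h : IsAbsNabla f (z • f)) : f = 0 := by
  refine fourierL2.injective (Lp.ext ?_)
  have hnull : ∀ᵐ ξ : ℝ, freq ξ ≠ z.re := by
    have : volume (freq ⁻¹' {z.re}) = 0 := volume_freq_preimage (by simp)
    rw [ae_iff]; simp only [not_not]; exact this
  unfold IsAbsNabla at h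
  rw [map_smul] at h
  rw [map_zero]
  filter_upwards [h, hnull, Lp.coeFn_smul z (fourierL2 f),
    Lp.coeFn_zero ℂ 2 (volume : Measure ℝ)] with ξ h1 h2 h3 h4
  rw [h4, Pi.zero_apply]
  rw [h3, Pi.smul_apply, smul_eq_mul] at h1
  have h5 : (z - (freq ξ : ℂ)) * fourierL2 f ξ = 0 := by
    rw [sub_mul, h1, freq, sub_self]
  refine (mul_eq_zero.1 h5).resolve_left fun h6 => h2 ?_
  rw [sub_eq_zero.1 h6, Complex.ofReal_re]

/-- Outside `[0, ∞)` the operator `|∇| - z` has a bounded inverse. -/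
lemma exists_resolvent {z : ℂ} (hz : z ∉ Complex.ofReal '' Set.Ici 0) :
    ∃ T : L2 →L[ℂ] L2, (∀ f, IsAbsNabla (T f) (f + z • T f)) ∧
      ∀ f g, IsAbsNabla f g → T (g - z • f) = f := by
  have hcl : IsClosed (Complex.ofReal '' Set.Ici 0) :=
    Complex.isometry_ofReal.isClosedEmbedding.isClosedMap _ isClosed_Ici
  obtain ⟨δ, hδ, hball⟩ := Metric.isOpen_iff.1 hcl.isOpen_compl z hz
  have hfar : ∀ ξ, δ ≤ ‖(freq ξ : ℂ) - z‖ := by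
    intro ξ
    by_contra! hlt
    have : (freq ξ : ℂ) ∈ Metric.ball z δ := by rwa [Metric.mem_ball, dist_eq_norm]
    exact hball this ⟨freq ξ, freq_nonneg ξ, rfl⟩
  have hne : ∀ ξ, (freq ξ : ℂ) - z ≠ 0 := fun ξ h => by
    have := hfar ξ
    rw [h, norm_zero] at this
    linarith
  have hmeas : Measurable fun ξ => ((freq ξ : ℂ) - z)⁻¹ :=
    ((Complex.measurable_ofReal.comp measurable_freq).sub_const z).inv
  have hbd : ∀ ξ, ‖((freq ξ : ℂ) - z)⁻¹‖ ≤ δ⁻¹ := fun ξ => by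
    rw [norm_inv]; exact inv_anti₀ hδ (hfar ξ)
  set M := mulBdd (fun ξ => ((freq ξ : ℂ) - z)⁻¹) hmeas δ⁻¹ hbd with hM
  refine ⟨(fourierL2.symm.toContinuousLinearEquiv : L2 →L[ℂ] L2) ∘L M ∘L
    (fourierL2.toContinuousLinearEquiv : L2 →L[ℂ] L2), ?_, ?_⟩
  · intro f
    change IsAbsNabla (fourierL2.symm (M (fourierL2 f))) (f + z • fourierL2.symm (M (fourierL2 f)))
    unfold IsAbsNabla
    rw [map_add, map_smul, LinearIsometryEquiv.apply_symm_apply]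
    filter_upwards [coeFn_mulBdd _ hmeas δ⁻¹ hbd (fourierL2 f),
      Lp.coeFn_add (fourierL2 f) (z • M (fourierL2 f)),
      Lp.coeFn_smul z (M (fourierL2 f))] with ξ h1 h2 h3
    have h4 := hne ξ
    rw [h2, Pi.add_apply, h3, Pi.smul_apply, hM, h1, smul_eq_mul]
    change _ = (freq ξ : ℂ) * _
    field_simp
    ring
  · intro f g h
    change fourierL2.symm (M (fourierL2 (g - z • f))) = f
    rw [LinearIsometryEquiv.symm_apply_eq, map_sub, map_smul]
    refine Lp.ext ?_
    filter_upwards [coeFn_mulBdd _ hmeas δ⁻¹ hbd (fourierL2 g - z • fourierL2 f),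
      Lp.coeFn_sub (fourierL2 g) (z • fourierL2 f), Lp.coeFn_smul z (fourierL2 f), h]
      with ξ h1 h2 h3 h4
    have h5 := hne ξ
    rw [hM, h1, h2, Pi.sub_apply, h3, Pi.smul_apply, h4, smul_eq_mul]
    change ((freq ξ : ℂ) - z)⁻¹ * ((freq ξ : ℂ) * _ - _) = _
    field_simp

/-- Approximate eigenfunctions of `|∇|` for every `t ≥ 0`. -/
lemma exists_approx_eigen {t : ℝ} (ht : 0 ≤ t) {ε : ℝ} (hε : 0 < ε) :
    ∃ f g, IsAbsNabla f g ∧ f ≠ 0 ∧ ‖g - (t : ℂ) • f‖ ≤ ε * ‖f‖ := by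
  have hpi := Real.pi_pos
  -- On this interval of nonnegative frequencies the symbol takes values between `t` and `t + ε`.
  set I := Set.Icc (t / (2 * Real.pi)) ((t + ε) / (2 * Real.pi))
  have hI : MeasurableSet I := measurableSet_Icc
  have hvol : volume I ≠ ∞ := by simp [I]
  set u : L2 := indicatorConstLp 2 hI hvol (1 : ℂ)
  have hu : (u : ℝ → ℂ) =ᵐ[volume] I.indicator fun _ => 1 := indicatorConstLp_coeFn
  have hfreq : ∀ ξ ∈ I, |freq ξ - t| ≤ ε := by
    rintro ξ ⟨h1, h2⟩
    have h0 : 0 ≤ ξ := le_trans (by positivity) h1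
    rw [div_le_iff₀ (by positivity)] at h1
    rw [le_div_iff₀ (by positivity)] at h2
    rw [freq, abs_of_nonneg h0, abs_le]
    constructor <;> nlinarith
  have hmem : MemLp (fun ξ => (freq ξ : ℂ) * u ξ) 2 volume := by
    refine (Lp.memLp u).of_le_mul (c := t + ε) (AEStronglyMeasurable.mul
      (Complex.measurable_ofReal.comp measurable_freq).aestronglyMeasurable
      (Lp.aestronglyMeasurable u)) ?_
    filter_upwards [hu] with ξ h
    rw [norm_mul, h]
    by_cases hξ : ξ ∈ I
    · refine mul_le_mul_of_nonneg_right ?_ (norm_nonneg _)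
      have := (abs_le.1 (hfreq ξ hξ)).2
      rw [Complex.norm_real, Real.norm_of_nonneg (freq_nonneg ξ)]; linarith
    · rw [Set.indicator_of_notMem hξ]; simp
  refine ⟨fourierL2.symm u, fourierL2.symm hmem.toLp, ?_, ?_, ?_⟩
  · unfold IsAbsNabla
    rw [LinearIsometryEquiv.apply_symm_apply, LinearIsometryEquiv.apply_symm_apply]
    exact hmem.coeFn_toLp
  · rw [Ne, map_eq_zero_iff _ fourierL2.symm.injective, ← norm_eq_zero, norm_indicatorConstLp
      two_ne_zero ENNReal.ofNat_ne_top]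
    have : 0 < volume.real I := by
      rw [Real.volume_real_Icc_of_le (by gcongr; linarith)]
      rw [← sub_div]; have : 0 < t + ε - t := by linarith
      positivity
    rw [norm_one, one_mul]
    exact (Real.rpow_pos_of_pos this _).ne'
  · rw [← map_smul, ← map_sub, LinearIsometryEquiv.norm_map, LinearIsometryEquiv.norm_map]
    refine Lp.norm_le_mul_norm_of_ae_le_mul ?_
    filter_upwards [Lp.coeFn_sub hmem.toLp ((t : ℂ) • u), Lp.coeFn_smul (t : ℂ) u,
      hmem.coeFn_toLp, hu] with ξ h1 h2 h3 h4
    rw [h1, Pi.sub_apply, h2, Pi.smul_apply, h3, smul_eq_mul, ← sub_mul, norm_mul, h4]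
    by_cases hξ : ξ ∈ I
    · refine mul_le_mul_of_nonneg_right ?_ (norm_nonneg _)
      rw [← Complex.ofReal_sub, Complex.norm_real]
      exact hfreq ξ hξ
    · rw [Set.indicator_of_notMem hξ]; simp

/-! ### Adding finitely many eigenvectors to a spectral resolution -/

section Extend

variable {K H : Type*} [NormedAddCommGroup K] [InnerProductSpace ℂ K]
  [NormedAddCommGroup H] [InnerProductSpace ℂ H] {ι : Type*} [Fintype ι]

/-- An orthogonal decomposition of `H` into the range of an isometry `W` and the span of a finite
orthonormal family `v`. -/
structure IsSplitting (W : K →ₗᵢ[ℂ] H) (v : ι → H) : Prop where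
  orthonormal : Orthonormal ℂ v
  inner_eq_zero : ∀ u i, ⟪W u, v i⟫_ℂ = 0
  exists_eq : ∀ f : H, ∃ (u : K) (c : ι → ℂ), f = W u + ∑ i, c i • v i

lemma IsSplitting.inner_eq_zero' {W : K →ₗᵢ[ℂ] H} {v : ι → H} (h : IsSplitting W v)
    (i : ι) (u : K) : ⟪v i, W u⟫_ℂ = 0 := by
  rw [← inner_conj_symm, h.inner_eq_zero, map_zero]

lemma IsSplitting.inner_add {W : K →ₗᵢ[ℂ] H} {v : ι → H} (h : IsSplitting W v)
    (u : K) (c : ι → ℂ) (j : ι) :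
    ⟪v j, W u + ∑ i, c i • v i⟫_ℂ = c j := by
  rw [inner_add_right, h.inner_eq_zero', zero_add, h.orthonormal.inner_right_fintype]

lemma IsSplitting.inner_add_add {W : K →ₗᵢ[ℂ] H} {v : ι → H} (h : IsSplitting W v)
    (u u' : K) (c c' : ι → ℂ) :
    ⟪W u + ∑ i, c i • v i, W u' + ∑ i, c' i • v i⟫_ℂ =
      ⟪u, u'⟫_ℂ + ∑ i, (starRingEnd ℂ) (c i) * c' i := by
  rw [inner_add_left, inner_add_right, W.inner_map_map, sum_inner, inner_sum]
  simp only [inner_smul_right, h.inner_eq_zero, mul_zero, Finset.sum_const_zero, add_zero,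
    inner_smul_left, h.inner_add]

variable [CompleteSpace K] [CompleteSpace H]

/-- The coisometry `W*`. -/
abbrev coisometry (W : K →ₗᵢ[ℂ] H) : H →L[ℂ] K :=
  ContinuousLinearMap.adjoint W.toContinuousLinearMap

lemma coisometry_apply (W : K →ₗᵢ[ℂ] H) (u : K) : coisometry W (W u) = u := by
  refine ext_inner_left ℂ fun g => ?_
  rw [ContinuousLinearMap.adjoint_inner_right]
  exact W.inner_map_map g u

lemma inner_coisometry (W : K →ₗᵢ[ℂ] H) (u : K) (f : H) :
    ⟪u, coisometry W f⟫_ℂ = ⟪W u, f⟫_ℂ :=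
  ContinuousLinearMap.adjoint_inner_right _ _ _

namespace IsSplitting

variable {W : K →ₗᵢ[ℂ] H} {v : ι → H}

lemma coisometry_eq_zero (h : IsSplitting W v) (i : ι) : coisometry W (v i) = 0 := by
  refine ext_inner_left ℂ fun g => ?_
  rw [inner_coisometry, h.inner_eq_zero, inner_zero_right]

lemma coisometry_add (h : IsSplitting W v) (u : K) (c : ι → ℂ) :
    coisometry W (W u + ∑ i, c i • v i) = u := by
  rw [map_add, coisometry_apply, map_sum]
  simp [h.coisometry_eq_zero]

lemma norm_sq_add (h : IsSplitting W v) (u : K) (c : ι → ℂ) :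
    ‖W u + ∑ i, c i • v i‖ ^ 2 = ‖u‖ ^ 2 + ∑ i, ‖c i‖ ^ 2 := by
  have h1 := h.inner_add_add u u c c
  rw [inner_self_eq_norm_sq_to_K, inner_self_eq_norm_sq_to_K] at h1
  refine Complex.ofReal_injective ?_
  have h2 : ∀ i, ((‖c i‖ ^ 2 : ℝ) : ℂ) = (starRingEnd ℂ) (c i) * c i := fun i => by
    rw [← Complex.normSq_eq_conj_mul_self, Complex.normSq_eq_norm_sq]
  rw [Complex.ofReal_add, Complex.ofReal_sum, Finset.sum_congr rfl fun i _ => h2 i]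
  refine Eq.trans (Eq.trans ?_ h1) ?_ <;> push_cast <;> rfl

end IsSplitting

/-- The indicator function of `B` at `t`, as a complex number. -/
def indC (B : Set ℝ) (t : ℝ) : ℂ := B.indicator 1 t

lemma indC_inter (B C : Set ℝ) (t : ℝ) : indC (B ∩ C) t = indC B t * indC C t := by
  unfold indC
  by_cases h1 : t ∈ B <;> by_cases h2 : t ∈ C <;> simp [h1, h2]

lemma conj_indC (B : Set ℝ) (t : ℝ) : (starRingEnd ℂ) (indC B t) = indC B t := by
  unfold indC
  by_cases h : t ∈ B <;> simp [h]

lemma hasSum_indC {B : ℕ → Set ℝ} (hd : Pairwise (Function.onFun Disjoint B)) (t : ℝ) :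
    HasSum (fun n => indC (B n) t) (indC (⋃ n, B n) t) := by
  unfold indC
  by_cases h : ∃ n, t ∈ B n
  · obtain ⟨n, hn⟩ := h
    have h1 : (⋃ n, B n).indicator (1 : ℝ → ℂ) t = (B n).indicator 1 t := by
      rw [Set.indicator_of_mem (Set.mem_iUnion.2 ⟨n, hn⟩), Set.indicator_of_mem hn]
    rw [h1]
    refine hasSum_single n fun k hk => ?_
    exact Set.indicator_of_notMem (fun h2 => Set.disjoint_left.1 (hd hk) h2 hn) _
  · have h1 : t ∉ ⋃ n, B n := fun h2 => h (Set.mem_iUnion.1 h2)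
    rw [Set.indicator_of_notMem h1]
    have h2 : (fun n => (B n).indicator (1 : ℝ → ℂ) t) = fun _ => 0 := by
      ext n
      exact Set.indicator_of_notMem (fun h3 => h ⟨n, h3⟩) _
    rw [h2]
    exact hasSum_zero

/-- The operator `W E(B) W* + ∑ i, 1_B(μ i) ⟪v i, ·⟫ v i`. -/
def extendProj (E : ProjectionValuedMeasure K) (W : K →ₗᵢ[ℂ] H) (v : ι → H) (μ : ι → ℝ)
    (B : Set ℝ) : H →L[ℂ] H :=
  W.toContinuousLinearMap ∘L E.proj B ∘L coisometry W +
    ∑ i, indC B (μ i) • (innerSL ℂ (v i)).smulRight (v i)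

lemma extendProj_apply (E : ProjectionValuedMeasure K) (W : K →ₗᵢ[ℂ] H) (v : ι → H) (μ : ι → ℝ)
    (B : Set ℝ) (f : H) :
    extendProj E W v μ B f =
      W (E.proj B (coisometry W f)) + ∑ i, (indC B (μ i) * ⟪v i, f⟫_ℂ) • v i := by
  simp [extendProj, mul_smul]

lemma IsSplitting.extendProj_add {W : K →ₗᵢ[ℂ] H} {v : ι → H} (h : IsSplitting W v)
    (E : ProjectionValuedMeasure K) (μ : ι → ℝ) (B : Set ℝ) (u : K) (c : ι → ℂ) :
    extendProj E W v μ B (W u + ∑ i, c i • v i) =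
      W (E.proj B u) + ∑ i, (indC B (μ i) * c i) • v i := by
  rw [extendProj_apply, h.coisometry_add]
  simp only [h.inner_add]

/-- The spectral resolution `W E W* + ∑ i, δ_{μ i} ⟪v i, ·⟫ v i`. -/
def IsSplitting.extendPVM {W : K →ₗᵢ[ℂ] H} {v : ι → H} (h : IsSplitting W v)
    (E : ProjectionValuedMeasure K) (μ : ι → ℝ) : ProjectionValuedMeasure H where
  proj := extendProj E W v μ
  isStarProjection B hB := by
    have hE := E.isStarProjection B hB
    have hsa : ∀ u u' : K, ⟪E.proj B u, u'⟫_ℂ = ⟪u, E.proj B u'⟫_ℂ := fun u u' =>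
      (ContinuousLinearMap.isSelfAdjoint_iff_isSymmetric.1 hE.isSelfAdjoint) u u'
    refine ⟨?_, ?_⟩
    · ext1 f
      obtain ⟨u, c, rfl⟩ := h.exists_eq f
      change extendProj E W v μ B (extendProj E W v μ B _) = _
      rw [h.extendProj_add, h.extendProj_add]
      have h1 : E.proj B (E.proj B u) = E.proj B u :=
        congrArg (fun T : K →L[ℂ] K => T u) hE.isIdempotentElem
      rw [h1]
      congr 1
      refine Finset.sum_congr rfl fun i _ => ?_
      rw [← mul_assoc, ← indC_inter, Set.inter_self]
    · rw [ContinuousLinearMap.isSelfAdjoint_iff_isSymmetric]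
      intro f g
      obtain ⟨u, c, rfl⟩ := h.exists_eq f
      obtain ⟨u', c', rfl⟩ := h.exists_eq g
      change ⟪extendProj E W v μ B _, _⟫_ℂ = ⟪_, extendProj E W v μ B _⟫_ℂ
      rw [h.extendProj_add, h.extendProj_add, h.inner_add_add, h.inner_add_add, hsa]
      congr 1
      refine Finset.sum_congr rfl fun i _ => ?_
      rw [map_mul, conj_indC]; ring
  proj_empty := by
    ext1 f
    rw [extendProj_apply, E.proj_empty]
    simp [indC]
  proj_univ := by
    ext1 f
    obtain ⟨u, c, rfl⟩ := h.exists_eq f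
    rw [h.extendProj_add, E.proj_univ]
    simp [indC]
  proj_inter B C hB hC := by
    ext1 f
    obtain ⟨u, c, rfl⟩ := h.exists_eq f
    change _ = extendProj E W v μ B (extendProj E W v μ C _)
    rw [h.extendProj_add, h.extendProj_add, h.extendProj_add, E.proj_inter B C hB hC]
    congr 1
    refine Finset.sum_congr rfl fun i _ => ?_
    rw [indC_inter, mul_assoc]
  proj_iUnion B hB hd f := by
    simp only [extendProj_apply]
    refine ((E.proj_iUnion B hB hd _).mapL W.toContinuousLinearMap).add (hasSum_sum fun i _ => ?_)
    exact ((hasSum_indC hd (μ i)).mul_right _).smul_const _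

section

variable {W : K →ₗᵢ[ℂ] H} {v : ι → H} (h : IsSplitting W v) (E : ProjectionValuedMeasure K)
  (μ : ι → ℝ)

/-- The projected pieces stay orthogonal, so there are no cross terms. -/
lemma IsSplitting.scalarMeasure_extendPVM (u : K) (c : ι → ℂ) :
    (h.extendPVM E μ).scalarMeasure (W u + ∑ i, c i • v i) =
      E.scalarMeasure u + ∑ i, ENNReal.ofReal (‖c i‖ ^ 2) • Measure.dirac (μ i) := by
  refine Measure.ext fun B hB => ?_
  rw [ProjectionValuedMeasure.scalarMeasure_apply _ _ hB, Measure.add_apply,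
    ProjectionValuedMeasure.scalarMeasure_apply _ _ hB, Measure.finsetSum_apply]
  change ENNReal.ofReal (‖extendProj E W v μ B _‖ ^ 2) = _
  rw [h.extendProj_add, h.norm_sq_add, ENNReal.ofReal_add (by positivity)
    (Finset.sum_nonneg fun i _ => by positivity),
    ENNReal.ofReal_sum_of_nonneg fun i _ => by positivity]
  congr 1
  refine Finset.sum_congr rfl fun i _ => ?_
  rw [Measure.smul_apply, Measure.dirac_apply' _ hB, smul_eq_mul, indC]
  by_cases hi : μ i ∈ B <;> simp [hi]

instance (u : K) : IsFiniteMeasure (E.scalarMeasure u) :=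
  ⟨by rw [E.scalarMeasure_apply u MeasurableSet.univ]; exact ENNReal.ofReal_lt_top⟩

lemma integrable_id_scalarMeasure {u : K}
    (hu : ∫⁻ t, ENNReal.ofReal (t ^ 2) ∂(E.scalarMeasure u) < ∞) :
    Integrable (fun t : ℝ => t) (E.scalarMeasure u) := by
  have h2 : Integrable (fun t : ℝ => t ^ 2) (E.scalarMeasure u) := by
    refine ⟨by fun_prop, ?_⟩
    rw [hasFiniteIntegral_iff_ofReal (Filter.Eventually.of_forall fun t => by positivity)]
    exact hu
  refine ((integrable_const (1 : ℝ)).add h2).mono' (by fun_prop)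
    (Filter.Eventually.of_forall fun t => ?_)
  rw [Real.norm_eq_abs, Pi.add_apply, ← sq_abs t]
  nlinarith [sq_nonneg (|t| - 1), abs_nonneg t]

/-- If `A` acts as `A₀` on the range of `W` and as `μ i` on `v i`, the extended resolution
represents `A`. -/
lemma IsSplitting.extendPVM_represents {A₀ : K →ₗ.[ℂ] K} {A : H →ₗ.[ℂ] H}
    (hE : E.Represents A₀) (hdom : ∀ u, W u ∈ A.domain ↔ u ∈ A₀.domain)
    (hv : ∀ i, v i ∈ A.domain)
    (hA : ∀ (u : A₀.domain) (c : ι → ℂ) (hf : W u + ∑ i, c i • v i ∈ A.domain),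
      A ⟨_, hf⟩ = W (A₀ u) + ∑ i, (μ i * c i : ℂ) • v i) :
    (h.extendPVM E μ).Represents A := by
  have hsum : ∀ c : ι → ℂ, ∑ i, c i • v i ∈ A.domain := fun c =>
    A.domain.sum_mem fun i _ => A.domain.smul_mem _ (hv i)
  have hmem : ∀ (u : K) (c : ι → ℂ), W u + ∑ i, c i • v i ∈ A.domain ↔ u ∈ A₀.domain :=
      fun u c => by
    rw [← hdom, Submodule.add_mem_iff_left _ (hsum c)]
  constructor
  · intro f
    obtain ⟨u, c, rfl⟩ := h.exists_eq f
    rw [hmem, hE.1, h.scalarMeasure_extendPVM, lintegral_add_measure, lintegral_finsetSum_measure,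
      ENNReal.add_lt_top, and_iff_left]
    refine ENNReal.sum_lt_top.2 fun i _ => ?_
    rw [lintegral_smul_measure, lintegral_dirac]
    exact ENNReal.mul_lt_top ENNReal.ofReal_lt_top ENNReal.ofReal_lt_top
  · rintro ⟨f, hf⟩
    obtain ⟨u, c, rfl⟩ := h.exists_eq f
    have hu := (hmem u c).1 hf
    rw [hA ⟨u, hu⟩ c hf, h.inner_add_add, h.scalarMeasure_extendPVM, hE.2 ⟨u, hu⟩]
    have hint : ∀ i, Integrable (fun t : ℝ => t)
        (ENNReal.ofReal (‖c i‖ ^ 2) • Measure.dirac (μ i)) := fun i =>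
      (integrable_dirac (by simp)).smul_measure ENNReal.ofReal_ne_top
    rw [integral_add_measure (integrable_id_scalarMeasure E ((hE.1 u).1 hu))
      (integrable_finsetSum_measure.2 fun i _ => hint i),
      integral_finsetSum_measure fun i _ => hint i, Complex.ofReal_add, Complex.ofReal_sum]
    congr 1
    refine Finset.sum_congr rfl fun i _ => ?_
    rw [integral_smul_measure, integral_dirac, ENNReal.toReal_ofReal (by positivity), smul_eq_mul,
      Complex.ofReal_mul, ← Complex.normSq_eq_norm_sq, Complex.normSq_eq_conj_mul_self]
    ring

lemma IsSplitting.acSubspace_extendPVM (hac : ∀ u, E.scalarMeasure u ≪ volume) :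
    (h.extendPVM E μ).acSubspace = (Submodule.span ℂ (Set.range v))ᗮ := by
  ext f
  change (h.extendPVM E μ).scalarMeasure f ≪ volume ↔ _
  rw [ProjectionValuedMeasure.scalarMeasure_ac_iff]
  have hperp : f ∈ (Submodule.span ℂ (Set.range v))ᗮ ↔ ∀ i, ⟪v i, f⟫_ℂ = 0 := by
    rw [Submodule.mem_orthogonal]
    constructor
    · exact fun h1 i => h1 _ (Submodule.subset_span ⟨i, rfl⟩)
    · intro h1 u hu
      refine Submodule.span_induction ?_ ?_ ?_ ?_ hu
      · rintro _ ⟨i, rfl⟩; exact h1 i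
      · exact inner_zero_left _
      · intro a b _ _ ha hb
        rw [inner_add_left, ha, hb, add_zero]
      · intro a b _ hb
        rw [inner_smul_left, hb, mul_zero]
  rw [hperp]
  obtain ⟨u, c, rfl⟩ := h.exists_eq f
  change (∀ B, MeasurableSet B → volume B = 0 → extendProj E W v μ B _ = 0) ↔ _
  simp only [h.inner_add, h.extendProj_add]
  constructor
  · intro h1 i
    have hfin : (Set.range μ).Finite := Set.finite_range μ
    -- The finite set of all `μ i` is Lebesgue null but carries every point mass, so it detects each
    -- coefficient.
    have h2 := congrArg (fun g => ⟪v i, g⟫_ℂ) (h1 (Set.range μ) hfin.measurableSet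
      (hfin.measure_zero _))
    simp only [h.inner_add, inner_zero_right] at h2
    rwa [indC, Set.indicator_of_mem (Set.mem_range_self i), Pi.one_apply, one_mul] at h2
  · intro h1 B hB h0
    rw [(E.scalarMeasure_ac_iff u).1 (hac u) B hB h0]
    simp [h1]

end

end Extend

/-! ### Operators that are `|∇|` up to finitely many bound states -/

section Intertwines

variable {H : Type*} [NormedAddCommGroup H] [InnerProductSpace ℂ H]

/-- `A` is symmetric, `W` intertwines `|∇|` with `A`, and the orthogonal complement of the range of
`W` is in the domain of `A`. -/
structure Intertwines (W : L2 →ₗᵢ[ℂ] H) (A : H →ₗ.[ℂ] H) : Prop where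
  mem_domain_iff : ∀ u, W u ∈ A.domain ↔ u ∈ absNabla.domain
  apply_eq : ∀ {u g}, IsAbsNabla u g → ∀ hf, A ⟨W u, hf⟩ = W g
  symm : ∀ f g : A.domain, ⟪A f, (g : H)⟫_ℂ = ⟪(f : H), A g⟫_ℂ
  le_domain : (LinearMap.range W.toLinearMap)ᗮ ≤ A.domain

variable {W : L2 →ₗᵢ[ℂ] H} {A : H →ₗ.[ℂ] H}

lemma mem_range_orthogonal_iff {f : H} :
    f ∈ (LinearMap.range W.toLinearMap)ᗮ ↔ ∀ u, ⟪W u, f⟫_ℂ = 0 := by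
  rw [Submodule.mem_orthogonal]
  exact ⟨fun h u => h _ ⟨u, rfl⟩, by rintro h _ ⟨u, rfl⟩; exact h u⟩

lemma Intertwines.apply_eq_of_eq (h : Intertwines W A) {u g : L2} (hu : IsAbsNabla u g) {f : H}
    (hf : f = W u) (hf' : f ∈ A.domain) : A ⟨f, hf'⟩ = W g := by
  subst hf
  exact h.apply_eq hu hf'

lemma Intertwines.apply_add (h : Intertwines W A) {ι : Type*} [Fintype ι] {v : ι → H} {μ : ι → ℝ}
    (hv : ∀ i, ∃ hi : v i ∈ A.domain, A ⟨v i, hi⟩ = (μ i : ℂ) • v i) {u : L2}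
    (hu : u ∈ absNabla.domain) (c : ι → ℂ) (hf : W u + ∑ i, c i • v i ∈ A.domain) :
    A ⟨_, hf⟩ = W (absNabla ⟨u, hu⟩) + ∑ i, (μ i * c i : ℂ) • v i := by
  choose hv1 hv2 using hv
  have h1 : (⟨_, hf⟩ : A.domain) =
      ⟨W u, (h.mem_domain_iff u).2 hu⟩ + ∑ i, c i • (⟨v i, hv1 i⟩ : A.domain) := by
    refine Subtype.ext ?_
    rw [Submodule.coe_add, Submodule.coe_sum]
    rfl
  rw [h1, A.map_add, h.apply_eq (isAbsNabla_absNabla ⟨u, hu⟩)]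
  have h2 : A (∑ i, c i • (⟨v i, hv1 i⟩ : A.domain)) = ∑ i, c i • A ⟨v i, hv1 i⟩ := by
    change A.toFun _ = _
    rw [map_sum]
    refine Finset.sum_congr rfl fun i _ => map_smul _ _ _
  rw [h2]
  congr 1
  refine Finset.sum_congr rfl fun i _ => ?_
  rw [hv2, smul_smul, mul_comm]

/-- For `u` in the domain of `|∇|`, symmetry gives `⟪W u, A n⟫ = ⟪W |∇| u, n⟫ = 0`; density of that
domain and continuity give it for all `u`. -/
lemma Intertwines.apply_mem (h : Intertwines W A) {n : H}
    (hn : n ∈ (LinearMap.range W.toLinearMap)ᗮ) :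
    A ⟨n, h.le_domain hn⟩ ∈ (LinearMap.range W.toLinearMap)ᗮ := by
  rw [mem_range_orthogonal_iff]
  have hcl : IsClosed {u : L2 | ⟪W u, A ⟨n, h.le_domain hn⟩⟫_ℂ = 0} :=
    isClosed_eq (W.continuous.inner continuous_const) continuous_const
  have hsub : (absNabla.domain : Set L2) ⊆ {u : L2 | ⟪W u, A ⟨n, h.le_domain hn⟩⟫_ℂ = 0} := by
    intro u hu
    have h1 := isAbsNabla_absNabla ⟨u, hu⟩
    have h2 := h.symm ⟨W u, (h.mem_domain_iff u).2 hu⟩ ⟨n, h.le_domain hn⟩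
    rw [h.apply_eq h1] at h2
    exact h2.symm.trans (mem_range_orthogonal_iff.1 hn _)
  intro u
  exact hcl.closure_subset_iff.2 hsub (dense_absNabla_domain u)

variable [CompleteSpace H]

instance : CompleteSpace (LinearMap.range W.toLinearMap) :=
  IsClosed.completeSpace_coe (hs := W.isometry.isClosedEmbedding.isClosed_range)

lemma mem_range_orthogonal_orthogonal_iff {f : H} :
    f ∈ (LinearMap.range W.toLinearMap)ᗮᗮ ↔ ∃ u, W u = f := by
  rw [Submodule.orthogonal_orthogonal]; rfl

/-- The restriction of `A` to the finite-dimensional invariant complement is symmetric, so it has an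
orthonormal eigenbasis with real eigenvalues. -/
lemma Intertwines.exists_splitting (h : Intertwines W A)
    [FiniteDimensional ℂ (LinearMap.range W.toLinearMap)ᗮ] :
    ∃ (d : ℕ) (v : Fin d → H) (μ : Fin d → ℝ), IsSplitting W v ∧
      Submodule.span ℂ (Set.range v) = (LinearMap.range W.toLinearMap)ᗮ ∧
      ∀ i, ∃ hi : v i ∈ A.domain, A ⟨v i, hi⟩ = (μ i : ℂ) • v i := by
  set N := (LinearMap.range W.toLinearMap)ᗮ with hN
  let T : N →ₗ[ℂ] N :=
    { toFun := fun n => ⟨A ⟨n, h.le_domain n.2⟩, h.apply_mem n.2⟩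
      map_add' := fun a b => Subtype.ext
        (A.map_add ⟨a, h.le_domain a.2⟩ ⟨b, h.le_domain b.2⟩)
      map_smul' := fun c a => Subtype.ext (A.map_smul c ⟨a, h.le_domain a.2⟩) }
  have hT : T.IsSymmetric := fun a b =>
    h.symm ⟨a, h.le_domain a.2⟩ ⟨b, h.le_domain b.2⟩
  let b := hT.eigenvectorBasis (n := Module.finrank ℂ N) rfl
  refine ⟨Module.finrank ℂ N, fun i => b i, hT.eigenvalues rfl, ⟨?_, ?_, ?_⟩, ?_, ?_⟩
  · exact b.orthonormal.comp_linearIsometry N.subtypeₗᵢ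
  · exact fun u i => mem_range_orthogonal_iff.1 (b i).2 u
  · intro f
    obtain ⟨u, hu⟩ := mem_range_orthogonal_orthogonal_iff.1
      (Submodule.starProjection_apply_mem Nᗮ f)
    have hn : f - Nᗮ.starProjection f ∈ N := by
      have := Submodule.sub_starProjection_mem_orthogonal (K := Nᗮ) f
      rwa [Submodule.orthogonal_orthogonal] at this
    refine ⟨u, fun i => b.repr ⟨_, hn⟩ i, ?_⟩
    have h1 := congrArg (Subtype.val) (b.sum_repr ⟨_, hn⟩)
    rw [Submodule.coe_sum] at h1
    simp only [Submodule.coe_smul] at h1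
    rw [h1, hu]; abel
  · have h1 : Set.range (fun i => (b i : H)) = N.subtype '' Set.range b := by
      rw [← Set.range_comp]; rfl
    have h2 : Submodule.span ℂ (Set.range b) = ⊤ := by
      have := b.toBasis.span_eq
      rwa [OrthonormalBasis.coe_toBasis] at this
    rw [h1, ← Submodule.map_span, h2, Submodule.map_top, Submodule.range_subtype]
  · intro i
    refine ⟨h.le_domain (b i).2, ?_⟩
    have h1 := hT.apply_eigenvectorBasis rfl i
    exact congrArg Subtype.val h1

/-- Applying `W*` to the eigenvalue equation of `W u + n`, with `n` in the complement, gives `|∇| u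
= E u`, so `u = 0`. Conversely the complement is spanned by eigenvectors. -/
lemma Intertwines.boundStates_eq (h : Intertwines W A)
    [FiniteDimensional ℂ (LinearMap.range W.toLinearMap)ᗮ] :
    boundStates A = (LinearMap.range W.toLinearMap)ᗮ := by
  obtain ⟨d, v, μ, hs, hspan, hv⟩ := h.exists_splitting
  refine le_antisymm ?_ ?_
  · refine Submodule.topologicalClosure_minimal _ (Submodule.span_le.2 ?_)
      (Submodule.isClosed_orthogonal _)
    rintro f ⟨hf, E, hE⟩
    obtain ⟨u, c, rfl⟩ := hs.exists_eq f
    have hsum : ∑ i, c i • v i ∈ (LinearMap.range W.toLinearMap)ᗮ := by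
      rw [← hspan]
      exact Submodule.sum_mem _ fun i _ =>
        Submodule.smul_mem _ _ (Submodule.subset_span ⟨i, rfl⟩)
    have hu : u ∈ absNabla.domain := by
      rw [← h.mem_domain_iff]
      exact (Submodule.add_mem_iff_left _ (h.le_domain hsum)).1 hf
    rw [h.apply_add hv hu c hf] at hE
    have h1 := congrArg (coisometry W) hE
    rw [hs.coisometry_add, map_smul, hs.coisometry_add] at h1
    have h2 : IsAbsNabla u (absNabla ⟨u, hu⟩) := isAbsNabla_absNabla ⟨u, hu⟩
    rw [h1] at h2
    rw [h2.eq_zero_of_eigen, map_zero, zero_add]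
    exact hsum
  · rw [← hspan]
    refine Submodule.span_le.2 ?_
    rintro _ ⟨i, rfl⟩
    obtain ⟨hi, hi'⟩ := hv i
    exact Submodule.le_topologicalClosure _ (Submodule.subset_span ⟨hi, μ i, hi'⟩)

lemma Intertwines.operatorSpectrum_part (h : Intertwines W A) {K : Submodule ℂ H}
    (hK : ∀ f, f ∈ K ↔ ∃ u, W u = f) :
    operatorSpectrum (part A K) = Complex.ofReal '' Set.Ici 0 := by
  have hWK : ∀ u, W u ∈ K := fun u => (hK _).2 ⟨u, rfl⟩
  ext z
  constructor
  · intro hz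
    by_contra hz'
    obtain ⟨S, hS1, hS2⟩ := exists_resolvent hz'
    -- The resolvent of `|∇|` conjugated by `W` inverts the part of `A` in `K`.
    refine hz ⟨(W.toContinuousLinearMap ∘L S ∘L coisometry W ∘L K.subtypeL).codRestrict K
      (fun f => hWK _), ?_, ?_⟩
    · rintro ⟨f, hf⟩
      obtain ⟨u, rfl⟩ := (hK f).1 hf
      have hval : W (S (coisometry W (W u))) = W (S u) := by rw [coisometry_apply]
      have hdom : W (S (coisometry W (W u))) ∈ A.domain := by
        rw [hval, h.mem_domain_iff]; exact (hS1 u).mem_domain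
      have hA : A ⟨W (S (coisometry W (W u))), hdom⟩ = W (u + z • S u) :=
        h.apply_eq_of_eq (hS1 u) hval hdom
      refine ⟨⟨hdom, ?_⟩, Subtype.ext ?_⟩
      · have := hWK (u + z • S u)
        rw [← hA] at this
        exact this
      · change A ⟨W (S (coisometry W (W u))), hdom⟩ - z • W (S (coisometry W (W u))) = W u
        rw [hA, hval, map_add, map_smul, add_sub_cancel_right]
    · rintro ⟨⟨f, hf⟩, hf1, hf2⟩
      obtain ⟨u, rfl⟩ := (hK f).1 hf
      have hu := isAbsNabla_absNabla ⟨u, (h.mem_domain_iff u).1 hf1⟩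
      refine Subtype.ext ?_
      change W (S (coisometry W (A ⟨W u, hf1⟩ - z • W u))) = W u
      rw [h.apply_eq hu, ← map_smul, ← map_sub, coisometry_apply, hS2 _ _ hu]
  · rintro ⟨t, ht, rfl⟩ ⟨T, -, hT⟩
    -- A bounded inverse `T` forces `‖f‖ ≤ ‖T‖ ‖g - t f‖`; the choice of `ε` makes the right side at
    -- most `‖f‖ / 2`, a contradiction.
    obtain ⟨f, g, hfg, hf0, hle⟩ := exists_approx_eigen ht
      (show (0 : ℝ) < 1 / (2 * (‖T‖ + 1)) by positivity)
    have hdom : W f ∈ A.domain := (h.mem_domain_iff f).2 hfg.mem_domain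
    have hmem : (⟨W f, hWK f⟩ : K) ∈ (part A K).domain :=
      ⟨hdom, by rw [h.apply_eq hfg]; exact hWK g⟩
    have h1 := hT ⟨⟨W f, hWK f⟩, hmem⟩
    have h2 : part A K ⟨⟨W f, hWK f⟩, hmem⟩ - (t : ℂ) • (⟨W f, hWK f⟩ : K) =
        ⟨W (g - (t : ℂ) • f), hWK _⟩ := by
      refine Subtype.ext ?_
      change A ⟨W f, hdom⟩ - (t : ℂ) • W f = _
      rw [h.apply_eq hfg]
      change _ = W (g - (t : ℂ) • f)
      rw [map_sub, map_smul]
    have h3 : ‖f‖ ≤ ‖T‖ * ‖g - (t : ℂ) • f‖ := by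
      have h4 := T.le_opNorm ⟨W (g - (t : ℂ) • f), hWK _⟩
      rw [← h2, h1, h2] at h4
      simpa only [Submodule.coe_norm, LinearIsometry.norm_map] using h4
    have hf : 0 < ‖f‖ := norm_pos_iff.2 hf0
    have h5 : ‖T‖ * ‖g - (t : ℂ) • f‖ ≤ ‖T‖ * (1 / (2 * (‖T‖ + 1)) * ‖f‖) := by gcongr
    have h6 : ‖T‖ * (1 / (2 * (‖T‖ + 1)) * ‖f‖) ≤ (1 / 2) * ‖f‖ := by
      rw [← mul_assoc]
      gcongr
      have := norm_nonneg T
      rw [mul_one_div, div_le_div_iff₀ (by positivity) (by norm_num)]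
      linarith
    linarith

theorem Intertwines.hasPurelyACSpectrumOffBoundStates (h : Intertwines W A)
    [FiniteDimensional ℂ (LinearMap.range W.toLinearMap)ᗮ] :
    HasPurelyACSpectrumOffBoundStates A (Set.Ici 0) := by
  obtain ⟨d, v, μ, hs, hspan, hv⟩ := h.exists_splitting
  refine ⟨hs.extendPVM freqPVM μ, ?_, ?_, ?_⟩
  · exact hs.extendPVM_represents freqPVM μ freqPVM_represents h.mem_domain_iff
      (fun i => (hv i).1) (fun u c hf => h.apply_add hv u.2 c hf)
  · rw [hs.acSubspace_extendPVM freqPVM μ scalarMeasure_freqPVM_ac, hspan, h.boundStates_eq]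
  · rw [h.boundStates_eq]
    exact h.operatorSpectrum_part fun f => mem_range_orthogonal_orthogonal_iff

end Intertwines

/-! ### Application to `L₊` and `L₋`. -/

lemma intertwines_Lplus (m : ℕ) : Intertwines (gaugeIsometry m) (Lplus m) where
  mem_domain_iff _ := gaugeU_mem_domain_iff
  apply_eq h hf := Lplus_gaugeU h hf
  symm := Lplus_symm
  le_domain := gaugeCompl_le_domain m

lemma intertwines_Lminus (m : ℕ) : Intertwines (gaugeIsometry m) (Lminus m) where
  mem_domain_iff _ := gaugeU_mem_domain_iff
  apply_eq h hf := Lminus_gaugeU h hf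
  symm := Lminus_symm
  le_domain := gaugeCompl_le_domain m

instance (m : ℕ) : FiniteDimensional ℂ (LinearMap.range (gaugeIsometry m).toLinearMap)ᗮ :=
  inferInstanceAs (FiniteDimensional ℂ (gaugeCompl m))

lemma boundStates_Lplus (m : ℕ) : boundStates (Lplus m) = gaugeCompl m :=
  (intertwines_Lplus m).boundStates_eq

lemma boundStates_Lminus (m : ℕ) : boundStates (Lminus m) = gaugeCompl m :=
  (intertwines_Lminus m).boundStates_eq

lemma Pperp_eq (m : ℕ) : Pperp m = (gaugeCompl m)ᗮ.starProjection := by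
  rw [Pperp, boundProj, Submodule.starProjection_orthogonal']
  congr 1
  ext1 f
  refine (Submodule.eq_starProjection_of_mem_of_inner_eq_zero ?_ fun w hw => ?_)
  · exact (boundStates_Lplus m).ge (Submodule.starProjection_apply_mem _ f)
  · exact Submodule.starProjection_inner_eq_zero f w ((boundStates_Lplus m).le hw)

lemma range_Pperp (m : ℕ) : LinearMap.range (Pperp m : L2 →ₗ[ℂ] L2) =
    LinearMap.range (gaugeU m : L2 →ₗ[ℂ] L2) := by
  rw [Pperp_eq, ← gaugeCompl_orthogonal]
  exact Submodule.range_starProjection _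

lemma Pperp_gaugeU (m : ℕ) (f : L2) : Pperp m (gaugeU m f) = gaugeU m f := by
  rw [Pperp_eq, Submodule.starProjection_eq_self_iff, gaugeCompl_orthogonal]
  exact ⟨f, rfl⟩

/-- Since `P^⊥ U = U`, both projections drop out, and `U* A U = U* U |∇| = |∇|` on the common
domain. -/
lemma sandwich_eq_absNabla {m : ℕ} {A : L2 →ₗ.[ℂ] L2} (h : Intertwines (gaugeIsometry m) A) :
    sandwich (ContinuousLinearMap.adjoint (gaugeU m) ∘L Pperp m) A (Pperp m ∘L gaugeU m) =
      absNabla := by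
  have hP : ∀ f, (Pperp m ∘L gaugeU m) f = gaugeIsometry m f := Pperp_gaugeU m
  refine LinearPMap.ext ?_ ?_
  · ext f
    change (Pperp m ∘L gaugeU m) f ∈ A.domain ↔ _
    rw [hP, h.mem_domain_iff]
  · intro f hf hf'
    have hf1 : (Pperp m ∘L gaugeU m) f ∈ A.domain := hf
    change ContinuousLinearMap.adjoint (gaugeU m)
      (Pperp m (A ⟨(Pperp m ∘L gaugeU m) f, hf1⟩)) = _
    rw [h.apply_eq_of_eq (isAbsNabla_absNabla ⟨f, hf'⟩) (hP f), gaugeIsometry_apply, Pperp_gaugeU,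
      adjoint_gaugeU_gaugeU]

end HalfHarmonic

end

theorem theorem5 (m : ℕ) (hm : 1 ≤ m) :
    -- `U` is a unitary map from `L²(ℝ)` onto `P^⊥ L²(ℝ)`, with its explicit adjoint
    (∃ V : L2 ≃ₗᵢ[ℂ] LinearMap.range (Pperp m : L2 →ₗ[ℂ] L2), ∀ f, (V f : L2) = gaugeU m f) ∧
    (∀ g ∈ LinearMap.range (Pperp m : L2 →ₗ[ℂ] L2),
      adjoint (gaugeU m) g = mulQConj m (projPos g) + mulQ m (projNeg g)) ∧
    -- `U* P^⊥ L₊ P^⊥ U = |∇|` and `U* P^⊥ L₋ P^⊥ U = |∇|`, including equality of domains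
    sandwich (adjoint (gaugeU m) ∘L Pperp m) (Lplus m) (Pperp m ∘L gaugeU m) = absNabla ∧
    sandwich (adjoint (gaugeU m) ∘L Pperp m) (Lminus m) (Pperp m ∘L gaugeU m) = absNabla ∧
    -- both operators have the same bound states, and purely absolutely continuous spectrum
    -- `[0, ∞)` on the complement
    boundStates (Lminus m) = boundStates (Lplus m) ∧
    HasPurelyACSpectrumOffBoundStates (Lplus m) (Set.Ici 0) ∧
    HasPurelyACSpectrumOffBoundStates (Lminus m) (Set.Ici 0) := by
  refine ⟨?_, ?_, sandwich_eq_absNabla (intertwines_Lplus m),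
    sandwich_eq_absNabla (intertwines_Lminus m),
    (boundStates_Lminus m).trans (boundStates_Lplus m).symm,
    (intertwines_Lplus m).hasPurelyACSpectrumOffBoundStates,
    (intertwines_Lminus m).hasPurelyACSpectrumOffBoundStates⟩
  · refine ⟨(gaugeIsometry m).equivRange.trans
      (LinearIsometryEquiv.ofEq _ _ (range_Pperp m).symm), fun f => rfl⟩
  · intro g hg
    rw [range_Pperp] at hg
    obtain ⟨f, rfl⟩ := hg
    -- On the range of `U` the adjoint and the explicit left inverse both recover `f` from `U f`.
    exact (adjoint_gaugeU_gaugeU m f).trans (gaugeU_leftInverse m f).symm
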